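/- **Setting.** Let $\mathcal H$ be a complex Hilbert space of finite dimension $N$ and let $n\in\mathbb N$ ($n\ge 0$). Put $\mathbb T^d=\mathbb R^d/\mathbb Z^d$ ($d \ge 0$; $\mathbb T^0=\{0\}$) and $\mathcal G_n(\mathcal H)=\{P\in\mathcal B(\mathcal H): P^2=P=P^*,\ \operatorname{Tr}P=n\}$. A *BDI pair* on $\mathcal H$ is a pair $(T,C)$ of anti-unitary operators with $T^2=C^2=\mathbb I$ such that $S:=TC$ satisfies $S^2=\mathbb I$. For a BDI pair $(T,C)$, let ${\rm BDI}(d,n,N)={\rm BDI}_{T,C}(d,n,N)$ be the set of continuous maps $P:\mathbb T^d\to\mathcal G_n(\mathcal H)$ with $$T^{-1}P(k)T=P(-k),\qquad C^{-1}P(k)C=\mathbb I-P(-k)\qquad(k\in\mathbb T^d).$$ Two elements $P_0,P_1$ are *homotopic* in ${\rm BDI}(d,n,N)$ if there is a family $P_s\in{\rm BDI}(d,n,N)$, $s\in[0,1]$, joining them, with $(s,k)\mapsto P_s(k)$ continuous. **Theorem (Class BDI).** 1. For every $d\ge 0$, there is a BDI pair $(T,C)$ on $\mathcal H$ for which ${\rm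 BDI}(d,n,N)\neq\emptyset$ if and only if $N=2n$. (In particular, for any BDI pair, ${\rm BDI}(d,n,N)\ne\emptyset$ implies $N=2n$.) 2. If ${\rm BDI}(d,n,N)\neq\emptyset$ for a BDI pair $(T,C)$ and some $d$, then there is an orthonormal basis of $\mathcal H$ in which $$T=\begin{pmatrix}K_n&0\\0&K_n\end{pmatrix},\qquad C=\begin{pmatrix}K_n&0\\0&-K_n\end{pmatrix},$$ where $K_n$ is the complex conjugation of $\mathbb C^n$. 3. Let $(T,C)$ be a BDI pair and fix any basis as in 2. Every $P\in{\rm BDI}(d,n,2n)$ has in this basis the form $$P(k)=\frac12\begin{pmatrix}\mathbb I_n&Q(k)\\Q(k)^*&\mathbb I_n\end{pmatrix},\qquad Q(k)\in{\rm U}(n).$$ * For $d=0$, the matrix $Q$ is real orthogonal, and $P\mapsto Q$ is a homeomorphism ${\rm BDI}(0,n,2n)\cong{\rm O}(n)$. * For $d=0$, set ${\rm Index}_0(P)=\det Q\in\{\pm1\}\simeq\mathbb Z_2$. Then $P_0,P_1$ are homotopic in ${\rm BDI}(0,n,2n)$ iff ${\rm Index}_0(P_0)={\rm Index}_0(P_1)$.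 If $n\ge1$, both values are attained. * For $d=1$, choose a continuous $\alpha:[0,\tfrac12]\to\mathbb R$ with $\det Q(k)=e^{i\alpha(k)}$ on $[0,\tfrac12]$, and set $\mathcal W^{1/2}(P)=\frac1\pi(\alpha(\tfrac12)-\alpha(0))$. Then $\det Q(0)\in\{\pm1\}$, $\mathcal W^{1/2}(P)\in\mathbb Z$, and with ${\rm Index}_1(P)=(\det Q(0),\mathcal W^{1/2}(P))\in\mathbb Z_2\times\mathbb Z$ the maps $P_0,P_1$ are homotopic in ${\rm BDI}(1,n,2n)$ iff ${\rm Index}_1(P_0)={\rm Index}_1(P_1)$. If $n\ge1$, all values in $\mathbb Z_2\times\mathbb Z$ are attained. -/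

import Mathlib

/-- The `d`-dimensional torus `ℝ^d / ℤ^d`. For `d = 0` it is a point. -/
abbrev Torus (d : ℕ) : Type := Fin d → UnitAddCircle

section

variable {H : Type*} [NormedAddCommGroup H] [InnerProductSpace ℂ H]

/-- The Grassmannian of rank-`n` orthogonal projections of a finite dimensional Hilbert space,
`{P : P² = P = P*, Tr P = n}`, inside the normed algebra of operators. -/
def grassmannian (H : Type*) [NormedAddCommGroup H] [InnerProductSpace ℂ H] (n : ℕ) :
    Set (H →L[ℂ] H) :=
  {P | P ∘L P = P ∧ (∀ x y : H, inner ℂ (P x) y = inner ℂ x (P y)) ∧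
    LinearMap.trace ℂ H (P : H →ₗ[ℂ] H) = (n : ℂ)}

/-- The symmetry operators of class BDI on a complex Hilbert space: antiunitary operators `T` and
`C` (bijective, conjugate-linear, isometric), both even (`T² = C² = 1`), whose product `S = TC`
(which is automatically unitary) satisfies `S² = 1`. -/
structure BDISymmetry (H : Type*) [NormedAddCommGroup H] [InnerProductSpace ℂ H] where
  T : H ≃ₗᵢ⋆[ℂ] H
  C : H ≃ₗᵢ⋆[ℂ] H
  T_even : ∀ x : H, T (T x) = x
  C_even : ∀ x : H, C (C x) = x
  S_sq : ∀ x : H, T (C (T (C x))) = x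

/-- The set `BDI(d, n, N)`, `N = dim H`, for given symmetry operators on `H`: the continuous
maps `P` from the `d`-torus to the rank-`n` orthogonal projections with `T⁻¹ P(k) T = P(-k)` and
`C⁻¹ P(k) C = 1 - P(-k)`. (These two imply `S⁻¹ P(k) S = 1 - P(k)` for `S = TC`.) -/
def BDI (σ : BDISymmetry H) (d n : ℕ) : Set C(Torus d, H →L[ℂ] H) :=
  {P | (∀ k, P k ∈ grassmannian H n) ∧
    (∀ k x, σ.T.symm (P k (σ.T x)) = P (-k) x) ∧
    (∀ k x, σ.C.symm (P k (σ.C x)) = x - P (-k) x)}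

/-- Two maps are homotopic in `BDI(d, n, N)`: they are joined by a homotopy
`(s, k) ↦ P_s(k)`, jointly continuous, with `P_s ∈ BDI(d, n, N)` for every `s ∈ [0,1]`. -/
def HomotopicInBDI (σ : BDISymmetry H) {d n : ℕ} (P₀ P₁ : BDI σ d n) : Prop :=
  ContinuousMap.HomotopicWith (P₀ : C(Torus d, H →L[ℂ] H)) (P₁ : C(Torus d, H →L[ℂ] H))
    (fun P => P ∈ BDI σ d n)

/-- An orthonormal basis of `H`, split into two halves of size `n`, in which
`T = diag(K, K)` and `C = diag(K, -K)`, where `K` is complex conjugation of coordinates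
(hence `S = TC = diag(1, -1)`). -/
structure IsNormalFormBasis (σ : BDISymmetry H) {n : ℕ}
    (b : OrthonormalBasis (Fin n ⊕ Fin n) ℂ H) : Prop where
  T_apply : ∀ i, σ.T (b i) = b i
  C_inl : ∀ j, σ.C (b (Sum.inl j)) = b (Sum.inl j)
  C_inr : ∀ j, σ.C (b (Sum.inr j)) = -b (Sum.inr j)

/-- The matrix of an operator in an orthonormal basis split into two halves. -/
noncomputable def matrixIn {n : ℕ} (b : OrthonormalBasis (Fin n ⊕ Fin n) ℂ H)
    (A : H →L[ℂ] H) : Matrix (Fin n ⊕ Fin n) (Fin n ⊕ Fin n) ℂ :=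
  LinearMap.toMatrix b.toBasis b.toBasis (A : H →ₗ[ℂ] H)

/-- Twice the upper right block of the matrix of `A`: this is `Q` when
`A = ½ [[1, Q], [Q*, 1]]`. -/
noncomputable def blockQ {n : ℕ} (b : OrthonormalBasis (Fin n ⊕ Fin n) ℂ H)
    (A : H →L[ℂ] H) : Matrix (Fin n) (Fin n) ℂ :=
  (2 : ℂ) • (matrixIn b A).toBlocks₁₂

end

/-- The point of the `1`-torus with coordinate `t`. -/
def torusPoint (t : ℝ) : Torus 1 := fun _ => (t : UnitAddCircle)

/-- `w` is the semi-winding over `[0, ½]` of `f`: for a continuous `α : [0, ½] → ℝ` with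
`f = exp(i α)`, `w = (α(½) - α(0)) / π`. Such an `α` is unique up to an additive constant, so
there is at most one such `w`. -/
def HasSemiWinding (f : ℝ → ℂ) (w : ℤ) : Prop :=
  ∃ α : ℝ → ℝ, ContinuousOn α (Set.Icc 0 (1 / 2)) ∧
    (∀ k ∈ Set.Icc (0 : ℝ) (1 / 2), f k = Complex.exp (Complex.I * (α k : ℂ))) ∧
    (w : ℝ) = (α (1 / 2) - α 0) / Real.pi

/-! In a normal-form basis the two symmetries force `P(k)` to be `½ [[1, Q], [Q*, 1]]` with `Q(k)`
unitary and `Q(-k)` the entrywise conjugate of `Q(k)` (`IsNormalFormBasis.mem_BDI_iff`). So `Q` is a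
matrix over the commutative real Banach algebra of functions with `f(-k) = conj f(k)`, and homotopy
in BDI becomes a question about path components of invertible matrices over that algebra; the polar
decomposition returns from invertible to unitary matrices and respects conjugation
(`homotopic_of_joinedIn_det`).

If units are dense in the algebra, a pivot can be perturbed to a unit, and row reduction along paths
shows that the determinant alone decides the component (`joinedIn_of_joinedIn_det`). Density is
elementary for `d = 0`; for `d = 1` it follows from approximation by real Laurent polynomials whose
zeros are moved off the unit circle. What remains is to join scalar determinants: a real sign for `d
= 0`, and for `d = 1` a phase on the half circle, where equal sign at `0` and equal semi-winding
allow an odd interpolation of phases (`joinedIn_units_of_hasSemiWinding`).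

Conversely, the indices agree for determinants at distance less than `2`, so they are constant along
homotopies (`eq_of_homotopic`). The normal form itself comes from a `T`-real basis of the range of
`P(0)`, which `C` carries to the kernel. -/

/-- Square matrices with invertible determinant. -/
def invertibleMatrices (ι A : Type*) [Fintype ι] [DecidableEq ι] [CommRing A] :
    Set (Matrix ι ι A) :=
  {M | IsUnit M.det}

/-! ### Paths of invertible matrices over a commutative Banach algebra -/

section MatrixPaths

theorem joinedIn_of_continuous {X : Type*} [TopologicalSpace X] {s : Set X} (f : ℝ → X)
    (hf : Continuous f) (hs : ∀ t, f t ∈ s) : JoinedIn s (f 0) (f 1) :=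
  JoinedIn.ofLine hf.continuousOn rfl rfl (by rintro _ ⟨t, -, rfl⟩; exact hs t)

theorem JoinedIn.map_of_mapsTo {X Y : Type*} [TopologicalSpace X] [TopologicalSpace Y] {s : Set X}
    {t : Set Y} {x y : X} (h : JoinedIn s x y) {f : X → Y} (hf : Continuous f)
    (hst : Set.MapsTo f s t) : JoinedIn t (f x) (f y) :=
  let ⟨γ, hγ⟩ := h
  ⟨γ.map hf, fun t => hst (hγ t)⟩

variable {ι κ A : Type*} [Fintype ι] [DecidableEq ι] [Fintype κ] [DecidableEq κ]
  [NormedCommRing A]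

theorem joinedIn_submatrix (e : ι ≃ κ) {M N : Matrix κ κ A}
    (h : JoinedIn (invertibleMatrices κ A) M N) :
    JoinedIn (invertibleMatrices ι A) (M.submatrix e e) (N.submatrix e e) :=
  h.map_of_mapsTo (f := fun M => M.submatrix e e) (by fun_prop) fun M hM => by
    simpa [invertibleMatrices, Matrix.det_submatrix_equiv_self] using hM

theorem isOpen_invertibleMatrices [CompleteSpace A] : IsOpen (invertibleMatrices ι A) :=
  Units.isOpen.preimage (continuous_id.matrix_det)

variable [NormedAlgebra ℝ A]

theorem joinedIn_transvection_mul {i j : ι} (hij : i ≠ j) (c : A) {M : Matrix ι ι A}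
    (hM : M ∈ invertibleMatrices ι A) :
    JoinedIn (invertibleMatrices ι A) M (Matrix.transvection i j c * M) := by
  have := joinedIn_of_continuous (s := invertibleMatrices ι A)
    (fun t : ℝ => Matrix.transvection i j (t • c) * M)
    (by
      unfold Matrix.transvection
      refine Continuous.mul (continuous_const.add ?_) continuous_const
      simp_rw [← Matrix.smul_single]
      fun_prop)
    (fun t => by
      simpa [invertibleMatrices, Matrix.det_transvection_of_ne _ _ hij] using hM)
  simpa using this

/-- Both off-diagonal blocks are shrunk by `1 - t` while the lower right block is corrected so that
the Schur complement `D - c * b`, hence the determinant, stays constant. -/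
theorem joinedIn_fromBlocks_one (b : Matrix ι κ A) (c : Matrix κ ι A) (D : Matrix κ κ A)
    (h : Matrix.fromBlocks 1 b c D ∈ invertibleMatrices (ι ⊕ κ) A) :
    JoinedIn (invertibleMatrices (ι ⊕ κ) A) (Matrix.fromBlocks 1 b c D)
      (Matrix.fromBlocks 1 0 0 (D - c * b)) := by
  have := joinedIn_of_continuous (s := invertibleMatrices (ι ⊕ κ) A)
    (fun t : ℝ => Matrix.fromBlocks 1 ((1 - t) • b) ((1 - t) • c)
      (D - (1 - (1 - t) * (1 - t)) • (c * b)))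
    (Continuous.matrix_fromBlocks (by fun_prop) (by fun_prop) (by fun_prop) (by fun_prop))
    (fun t => by
      rw [invertibleMatrices, Set.mem_ofPred_eq, Matrix.det_fromBlocks_one₁₁] at h ⊢
      convert h using 2
      rw [Matrix.smul_mul, Matrix.mul_smul, smul_smul, sub_sub, ← add_smul]
      simp)
  simpa using this

variable [CompleteSpace A]

/-- If units are dense, an entry of an invertible matrix can be made a unit. -/
theorem exists_joinedIn_isUnit_entry (hA : Dense {a : A | IsUnit a}) (i j : ι) {M : Matrix ι ι A}
    (hM : M ∈ invertibleMatrices ι A) :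
    ∃ N, JoinedIn (invertibleMatrices ι A) M N ∧ IsUnit (N i j) := by
  have hc : Continuous fun x : A => M + Matrix.single i j x :=
    continuous_const.add (continuous_matrix fun k l => by
      simp only [Matrix.single, Matrix.of_apply]; split_ifs <;> fun_prop)
  have ho : IsOpen ((fun x : A => M + Matrix.single i j x) ⁻¹' invertibleMatrices ι A) :=
    isOpen_invertibleMatrices.preimage hc
  -- Perturbations of the entry that keep the matrix invertible contain a ball, so the whole segment
  -- to a nearby unit value is admissible.
  obtain ⟨ε, hε, hball⟩ := Metric.isOpen_iff.1 ho 0 (by simpa using hM)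
  obtain ⟨u, hu, hd⟩ := hA.exists_dist_lt (M i j) hε
  rw [dist_comm, dist_eq_norm] at hd
  have key : ∀ t ∈ Set.Icc (0 : ℝ) 1, M + Matrix.single i j (t • (u - M i j)) ∈
      invertibleMatrices ι A := fun t ht => hball (by
    rw [mem_ball_zero_iff, norm_smul, Real.norm_of_nonneg ht.1]
    exact (mul_le_of_le_one_left (norm_nonneg _) ht.2).trans_lt hd)
  refine ⟨M + Matrix.single i j (u - M i j), ?_, by simpa using hu⟩
  refine JoinedIn.ofLine (f := fun t : ℝ => M + Matrix.single i j (t • (u - M i j)))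
    (hc.comp (by fun_prop)).continuousOn (by simp) (by simp) ?_
  rintro _ ⟨t, ht, rfl⟩
  exact key t ht

/-- One step of Gaussian elimination along paths: create a pivot `1` in the corner, then contract
its row and column. -/
theorem exists_joinedIn_one_fromBlocks (hA : Dense {a : A | IsUnit a}) {n : ℕ}
    {M : Matrix (Fin (n + 2)) (Fin (n + 2)) A} (hM : M ∈ invertibleMatrices _ A) :
    ∃ D : Matrix (Fin (n + 1)) (Fin (n + 1)) A, D ∈ invertibleMatrices _ A ∧
      JoinedIn (invertibleMatrices _ A) M
        ((Matrix.fromBlocks 1 0 0 D : Matrix (Fin 1 ⊕ Fin (n + 1)) (Fin 1 ⊕ Fin (n + 1)) A).submatrix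
          (finSumFinEquiv.trans (finCongr (by ring))).symm
          (finSumFinEquiv.trans (finCongr (by ring))).symm) := by
  -- The unit is wanted below the corner, not in it: a multiple of row `1` added to row `0` then
  -- makes the corner exactly `1`. This needs size at least two.
  obtain ⟨N, hMN, u, hu⟩ := exists_joinedIn_isUnit_entry hA 1 0 hM
  set c : A := (1 - N 0 0) * ↑u⁻¹
  set L := Matrix.transvection 0 1 c * N with hL
  have hNL : JoinedIn (invertibleMatrices _ A) N L :=
    joinedIn_transvection_mul (by simp) c hMN.target_mem
  have hL0 : L 0 0 = 1 := by
    rw [hL, Matrix.transvection_mul_apply_same, ← hu]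
    simp [c]
  set e : Fin 1 ⊕ Fin (n + 1) ≃ Fin (n + 2) := finSumFinEquiv.trans (finCongr (by ring))
  have he : e (Sum.inl 0) = 0 := by ext; simp [e]
  have hblocks : L.submatrix e e = Matrix.fromBlocks 1 (L.submatrix e e).toBlocks₁₂
      (L.submatrix e e).toBlocks₂₁ (L.submatrix e e).toBlocks₂₂ := by
    conv_lhs => rw [← Matrix.fromBlocks_toBlocks (L.submatrix e e)]
    congr
    ext i j
    rw [Subsingleton.elim i 0, Subsingleton.elim j 0]
    simp [Matrix.toBlocks₁₁, he, hL0]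
  have hLe : L.submatrix e e ∈ invertibleMatrices _ A := by
    simpa [invertibleMatrices, Matrix.det_submatrix_equiv_self] using hNL.target_mem
  rw [hblocks] at hLe
  have h3 := joinedIn_fromBlocks_one _ _ _ hLe
  have h4 := joinedIn_submatrix e.symm h3
  rw [← hblocks] at h4
  refine ⟨_, ?_, (hMN.trans hNL).trans (by simpa using h4)⟩
  · simpa [invertibleMatrices, Matrix.det_fromBlocks_zero₁₂] using h3.target_mem

/-- Induction on the size by elimination. A `1 × 1` matrix is its own determinant, so there the
hypothesis is the path itself. -/
theorem joinedIn_one_of_joinedIn_det (hA : Dense {a : A | IsUnit a}) :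
    ∀ (n : ℕ) {M : Matrix (Fin n) (Fin n) A}, JoinedIn {a : A | IsUnit a} M.det 1 →
      JoinedIn (invertibleMatrices (Fin n) A) M 1
  | 0, M, h => by
    rw [Subsingleton.elim M 1]
    exact JoinedIn.refl (by simp [invertibleMatrices])
  | 1, M, h => by
    have := h.map_of_mapsTo (f := fun a => Matrix.diagonal fun _ : Fin 1 => a)
      (t := invertibleMatrices (Fin 1) A) (by fun_prop)
      (fun a ha => by simpa [invertibleMatrices] using ha)
    convert this
    · ext i j; fin_cases i; fin_cases j; simp
    · simp
  | n + 2, M, h => by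
    obtain ⟨D, hD, hMD⟩ := exists_joinedIn_one_fromBlocks hA h.source_mem
    -- The determinant of the elimination path joins `det M` to `det D`, so the smaller block
    -- inherits the hypothesis.
    have hdet := hMD.map_of_mapsTo (f := Matrix.det) (t := {a : A | IsUnit a})
      continuous_id.matrix_det (fun a ha => ha)
    rw [Matrix.det_submatrix_equiv_self, Matrix.det_fromBlocks_zero₁₂, Matrix.det_one, one_mul]
      at hdet
    have hD1 := joinedIn_one_of_joinedIn_det hA (n + 1) (hdet.symm.trans h)
    have := hD1.map_of_mapsTo
      (f := fun D => (Matrix.fromBlocks 1 0 0 D : Matrix (Fin 1 ⊕ Fin (n + 1)) _ A))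
      (t := invertibleMatrices _ A)
      (Continuous.matrix_fromBlocks continuous_const continuous_const continuous_const
        continuous_id)
      (fun D hD => by simpa [invertibleMatrices, Matrix.det_fromBlocks_zero₁₂] using hD)
    rw [Matrix.fromBlocks_one] at this
    have := joinedIn_submatrix
      (finSumFinEquiv.trans (finCongr (by ring : 1 + (n + 1) = n + 2))).symm this
    rw [Matrix.submatrix_one_equiv] at this
    exact hMD.trans this

/-- Over a commutative real Banach algebra with dense units, invertible matrices are joined as
soon as their determinants are joined among the units. -/
theorem joinedIn_of_joinedIn_det (hA : Dense {a : A | IsUnit a}) {n : ℕ}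
    {M N : Matrix (Fin n) (Fin n) A} (h : JoinedIn {a : A | IsUnit a} M.det N.det) :
    JoinedIn (invertibleMatrices (Fin n) A) M N := by
  obtain ⟨u, hu⟩ := h.target_mem
  have h1 : JoinedIn {a : A | IsUnit a} (N⁻¹ * M).det 1 := by
    have := h.map_of_mapsTo (f := fun a : A => (↑u⁻¹ : A) * a) (t := {a : A | IsUnit a}) (by fun_prop)
      (fun a ha => u⁻¹.isUnit.mul (show IsUnit a from ha))
    have hN : N⁻¹.det = ↑u⁻¹ := by
      rw [Matrix.det_nonsing_inv, ← hu, Ring.inverse_unit]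
    simpa [hN, ← hu] using this
  have := (joinedIn_one_of_joinedIn_det hA n h1).map_of_mapsTo (f := fun D => N * D)
    (t := invertibleMatrices (Fin n) A) (by fun_prop)
    (fun D hD => by
      simpa [invertibleMatrices] using ⟨h.target_mem, hD⟩)
  simpa [Matrix.mul_nonsing_inv_cancel_left _ _ h.target_mem] using this

end MatrixPaths

/-! ### The algebra of functions with `f(-k) = conj f(k)` and the density of its units -/

section SymmetricFunctions

open scoped ComplexConjugate

/-- The real algebra of continuous functions on the torus with `f (-k) = conj (f k)`. -/
noncomputable def symmetricFunctions (d : ℕ) : Subalgebra ℝ C(Torus d, ℂ) where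
  carrier := {f | ∀ k, f (-k) = conj (f k)}
  mul_mem' hf hg k := by simp [hf k, hg k]
  add_mem' hf hg k := by simp [hf k, hg k]
  algebraMap_mem' r k := by simp

theorem isClosed_symmetricFunctions (d : ℕ) :
    IsClosed (symmetricFunctions d : Set C(Torus d, ℂ)) := by
  have : (symmetricFunctions d : Set C(Torus d, ℂ)) = ⋂ k, {f | f (-k) = conj (f k)} := by
    ext f; simp [symmetricFunctions]
  rw [this]
  exact isClosed_iInter fun k => isClosed_eq (continuous_eval_const _)
    (Complex.continuous_conj.comp (continuous_eval_const _))

/-- The Banach algebra of continuous functions on the torus with `f (-k) = conj (f k)`. -/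
def SymmetricFunction (d : ℕ) : Type := symmetricFunctions d

noncomputable instance (d : ℕ) : NormedCommRing (SymmetricFunction d) :=
  inferInstanceAs (NormedCommRing (symmetricFunctions d))

noncomputable instance (d : ℕ) : NormedAlgebra ℝ (SymmetricFunction d) :=
  inferInstanceAs (NormedAlgebra ℝ (symmetricFunctions d))

instance (d : ℕ) : CompleteSpace (SymmetricFunction d) :=
  (isClosed_symmetricFunctions d).completeSpace_coe

/-- Evaluation at a point of the torus. -/
noncomputable def evalAt {d : ℕ} (k : Torus d) : SymmetricFunction d →+* ℂ where
  toFun f := f.1 k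
  map_one' := rfl
  map_mul' _ _ := rfl
  map_zero' := rfl
  map_add' _ _ := rfl

theorem isUnit_symmetricFunctions {d : ℕ} {f : SymmetricFunction d} (hf : ∀ k, f.1 k ≠ 0) :
    IsUnit f := by
  let g : SymmetricFunction d := ⟨⟨fun k => (f.1 k)⁻¹, f.1.continuous.inv₀ hf⟩, fun k => by
    have := f.2 k
    simp_all⟩
  exact IsUnit.of_mul_eq_one g (Subtype.ext (ContinuousMap.ext fun k => mul_inv_cancel₀ (hf k)))

theorem mem_ball_symmetricFunctions {d : ℕ} {f g : SymmetricFunction d} {ε : ℝ} (hε : 0 < ε) :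
    g ∈ Metric.ball f ε ↔ ∀ k, dist (g.1 k) (f.1 k) < ε :=
  ContinuousMap.dist_lt_iff hε

theorem algebraMap_symmetricFunctions_apply {d : ℕ} (c : ℝ) (k : Torus d) :
    (algebraMap ℝ (SymmetricFunction d) c).1 k = c := rfl

theorem dense_units_symmetricFunctions_zero : Dense {f : SymmetricFunction 0 | IsUnit f} := by
  rw [Metric.dense_iff]
  intro f ε hε
  by_cases h0 : f.1 0 = 0
  · refine ⟨f + algebraMap ℝ _ (ε / 2), ?_, isUnit_symmetricFunctions fun k => ?_⟩
    · refine (mem_ball_symmetricFunctions hε).2 fun k => ?_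
      change dist (f.1 k + ((ε / 2 : ℝ) : ℂ)) (f.1 k) < ε
      rw [dist_eq_norm, add_sub_cancel_left, Complex.norm_real, Real.norm_of_nonneg (half_pos hε).le]
      exact half_lt_self hε
    · rw [Subsingleton.elim k 0]
      change f.1 0 + ((ε / 2 : ℝ) : ℂ) ≠ 0
      rw [h0, zero_add]
      exact_mod_cast (half_pos hε).ne'
  · refine ⟨f, Metric.mem_ball_self hε, isUnit_symmetricFunctions fun k => ?_⟩
    rwa [Subsingleton.elim k 0]

open Polynomial in
/-- Laurent polynomials in the basic character are dense in the functions on the circle. -/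
theorem exists_laurent_approx (f : C(UnitAddCircle, ℂ)) {ε : ℝ} (hε : 0 < ε) :
    ∃ (m : ℕ) (q : ℂ[X]), ∀ x : UnitAddCircle,
      ‖f x - fourier (-m : ℤ) x * q.eval (fourier 1 x)‖ < ε := by
  have hf : f ∈ (Submodule.span ℂ (Set.range <| @fourier (1 : ℝ))).topologicalClosure := by
    rw [span_fourier_closure_eq_top]; trivial
  obtain ⟨g, hg, hfg⟩ := Metric.mem_closure_iff.1 hf ε hε
  suffices h : ∃ (m : ℕ) (q : ℂ[X]), ∀ x : UnitAddCircle,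
      g x = fourier (-m : ℤ) x * q.eval (fourier 1 x) by
    obtain ⟨m, q, h⟩ := h
    refine ⟨m, q, fun x => ?_⟩
    rw [← h x, ← dist_eq_norm]
    exact (ContinuousMap.dist_apply_le_dist x).trans_lt hfg
  have hmul (a b : ℤ) (x : UnitAddCircle) : fourier a x * fourier b x = fourier (a + b) x :=
    fourier_add.symm
  have hpow (n : ℕ) (x : UnitAddCircle) : fourier 1 x ^ n = fourier n x := by
    induction n with
    | zero => simp
    | succ n ih => rw [pow_succ, ih, hmul]; simp
  clear hfg
  induction hg using Submodule.span_induction with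
  | mem g hg =>
    obtain ⟨a, rfl⟩ := hg
    -- `a + |a|` is nonnegative, so `z ^ a` is `z ^ (-|a|)` times a genuine polynomial.
    refine ⟨a.natAbs, X ^ (a + a.natAbs).toNat, fun x => ?_⟩
    rw [eval_pow, eval_X, hpow, hmul]
    congr 1
    congr 1
    omega
  | zero => exact ⟨0, 0, fun x => by simp⟩
  | add g h _ _ ihg ihh =>
    obtain ⟨m₁, q₁, h₁⟩ := ihg
    obtain ⟨m₂, q₂, h₂⟩ := ihh
    refine ⟨m₁ + m₂, X ^ m₂ * q₁ + X ^ m₁ * q₂, fun x => ?_⟩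
    rw [ContinuousMap.add_apply, h₁, h₂, eval_add, eval_mul, eval_mul, eval_pow, eval_pow, eval_X,
      hpow, hpow, mul_add, ← mul_assoc, ← mul_assoc, hmul, hmul]
    congr 4 <;> push_cast <;> ring
  | smul c g _ ihg =>
    obtain ⟨m, q, h⟩ := ihg
    refine ⟨m, C c * q, fun x => ?_⟩
    rw [ContinuousMap.smul_apply, h, eval_mul, eval_C, smul_eq_mul]
    ring

open Polynomial in
/-- The function `z⁻ᵐ q(r z)` on the `1`-torus. -/
noncomputable def laurentFun (m : ℕ) (q : ℂ[X]) (r : ℝ) : C(Torus 1, ℂ) :=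
  ⟨fun k => fourier (-m : ℤ) (k 0) * q.eval ((r : ℂ) * fourier 1 (k 0)), by fun_prop⟩

open Polynomial in
theorem laurentFun_apply (m : ℕ) (q : ℂ[X]) (r : ℝ) (k : Torus 1) :
    laurentFun m q r k = fourier (-m : ℤ) (k 0) * q.eval ((r : ℂ) * fourier 1 (k 0)) := rfl

open Polynomial in
theorem continuous_laurentFun (m : ℕ) (q : ℂ[X]) : Continuous (laurentFun m q) :=
  ContinuousMap.continuous_of_continuous_uncurry _ (by
    change Continuous fun p : ℝ × Torus 1 =>
      fourier (-m : ℤ) (p.2 0) * q.eval ((p.1 : ℂ) * fourier 1 (p.2 0))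
    fun_prop)

open Polynomial in
theorem conj_eval_map (q : ℂ[X]) (z : ℂ) :
    (q.map (starRingEnd ℂ)).eval (conj z) = conj (q.eval z) := by
  rw [eval_map, eval₂_at_apply]

open Polynomial in
-- Negating `k` conjugates the character, and conjugation passes through a polynomial with real
-- coefficients, at any real radius.
theorem laurentFun_mem (m : ℕ) (q : ℂ[X]) (hq : q.map (starRingEnd ℂ) = q) (r : ℝ) :
    laurentFun m q r ∈ symmetricFunctions 1 := fun k => by
  have hconj (n : ℤ) : fourier n (-k 0) = conj (fourier n (k 0)) := by
    rw [← fourier_neg]; simp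
  rw [laurentFun_apply, laurentFun_apply, Pi.neg_apply, hconj, hconj, map_mul, ← conj_eval_map, hq]
  simp

open Polynomial in
-- Average `q` with its coefficientwise conjugate: by the symmetry of `f`, the error of the
-- conjugate polynomial at `k` has the same norm as the error of `q` at `-k`.
theorem exists_symmetric_laurent_approx (f : SymmetricFunction 1) {ε : ℝ} (hε : 0 < ε) :
    ∃ (m : ℕ) (q : ℂ[X]), q.map (starRingEnd ℂ) = q ∧ dist (laurentFun m q 1) f.1 < ε := by
  obtain ⟨m, q, h⟩ := exists_laurent_approx
    (f.1.comp ⟨fun x => (fun _ => x : Torus 1), by fun_prop⟩) hε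
  refine ⟨m, C (1 / 2) * (q + q.map (starRingEnd ℂ)), ?_, ?_⟩
  · have : (q.map (starRingEnd ℂ)).map (starRingEnd ℂ) = q := by
      rw [Polynomial.map_map]; ext; simp
    rw [Polynomial.map_mul, Polynomial.map_add, this, map_C, add_comm (q.map _) q, map_div₀, map_one, map_ofNat]
  · rw [ContinuousMap.dist_lt_iff hε]
    intro k
    have h1 := h (k 0)
    have h2 := h (-k 0)
    have hk : (fun _ => k 0 : Torus 1) = k := by ext i; rw [Subsingleton.elim i 0]
    have hk' : (fun _ => -k 0 : Torus 1) = -k := by ext i; rw [Subsingleton.elim i 0]; rfl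
    have hconj (n : ℤ) : fourier n (-k 0) = conj (fourier n (k 0)) := by
      rw [← fourier_neg]; simp
    simp only [ContinuousMap.comp_apply, ContinuousMap.coe_mk, hk, hk'] at h1 h2
    rw [f.2 k, hconj, hconj, ← RCLike.norm_conj, map_sub, map_mul, ← conj_eval_map] at h2
    simp only [RCLike.conj_conj] at h2
    rw [dist_comm, dist_eq_norm, laurentFun_apply, Complex.ofReal_one, one_mul, eval_mul, eval_C,
      eval_add]
    set z := fourier 1 (k 0)
    set w := fourier (-m : ℤ) (k 0)
    calc ‖f.1 k - w * (1 / 2 * (q.eval z + (q.map (starRingEnd ℂ)).eval z))‖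
        = ‖(1 / 2 : ℂ) * (f.1 k - w * q.eval z) +
            (1 / 2 : ℂ) * (f.1 k - w * (q.map (starRingEnd ℂ)).eval z)‖ := by congr 1; ring
      _ ≤ _ := norm_add_le _ _
      _ < ε := by
        rw [norm_mul, norm_mul]
        norm_num
        linarith

/-- A nonzero polynomial has finitely many roots, so replacing `q(z)` by `q(r z)` with `r` real and
near `1` removes all zeros on the circle and keeps the symmetry. A zero approximant is replaced by a
small real constant. -/
theorem dense_units_symmetricFunctions_one : Dense {f : SymmetricFunction 1 | IsUnit f} := by
  rw [Metric.dense_iff]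
  intro f ε hε
  obtain ⟨m, q, hq, hd⟩ := exists_symmetric_laurent_approx f (half_pos hε)
  by_cases hq0 : q = 0
  · subst hq0
    have h0 : laurentFun m 0 1 = 0 := by ext k; simp [laurentFun_apply]
    rw [h0] at hd
    refine ⟨algebraMap ℝ _ (ε / 2), ?_, ?_⟩
    · refine (mem_ball_symmetricFunctions hε).2 fun k => ?_
      have h1 := (ContinuousMap.dist_apply_le_dist k).trans_lt hd
      rw [ContinuousMap.zero_apply] at h1
      refine (dist_triangle _ 0 _).trans_lt ?_
      rw [algebraMap_symmetricFunctions_apply, dist_zero_right, Complex.norm_real,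
        Real.norm_of_nonneg (half_pos hε).le]
      linarith
    · exact (IsUnit.mk0 (ε / 2) (half_pos hε).ne').map (algebraMap ℝ (SymmetricFunction 1))
  · have hopen : IsOpen ({r | dist (laurentFun m q r) f.1 < ε} ∩ Set.Ioi 0) :=
      (isOpen_lt ((continuous_laurentFun m q).dist continuous_const) continuous_const).inter
        isOpen_Ioi
    have hfin : ((fun z : ℂ => ‖z‖) '' (q.roots.toFinset : Set ℂ)).Finite :=
      (Finset.finite_toSet _).image _
    -- The radius avoids the moduli of all roots of `q`, so `r z` is never a root when `|z| = 1`.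
    obtain ⟨r, ⟨hr, hr0⟩, hrq⟩ := (hfin.countable.dense_compl ℝ).inter_open_nonempty _ hopen
      ⟨1, hd.trans (half_lt_self hε), Set.mem_Ioi.2 one_pos⟩
    refine ⟨⟨laurentFun m q r, laurentFun_mem m q hq r⟩, hr, isUnit_symmetricFunctions fun k => ?_⟩
    rw [laurentFun_apply]
    refine mul_ne_zero (by simp) fun h => hrq ⟨(r : ℂ) * fourier 1 (k 0), ?_, ?_⟩
    · simpa [hq0] using h
    · have := Circle.norm_coe (AddCircle.toCircle (k 0))
      simp [abs_of_pos (show (0 : ℝ) < r from hr0), this]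

end SymmetricFunctions

/-! ### The polar decomposition: continuity and compatibility with conjugation -/

section Polar

open scoped Matrix.Norms.L2Operator MatrixOrder ComplexOrder
open Matrix

variable {ι : Type*} [Fintype ι] [DecidableEq ι]

/-- The unitary part `M |M|⁻¹` of the polar decomposition. -/
noncomputable def polarUnitary (M : Matrix ι ι ℂ) : Matrix ι ι ℂ :=
  M * (CFC.sqrt (Mᴴ * M))⁻¹

theorem isUnit_sqrt_conjTranspose_mul_self {M : Matrix ι ι ℂ} (hM : IsUnit M.det) :
    IsUnit (CFC.sqrt (Mᴴ * M)).det := by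
  have h := congrArg Matrix.det
    (CFC.sqrt_mul_sqrt_self (Mᴴ * M) (posSemidef_conjTranspose_mul_self M).nonneg)
  rw [det_mul, det_mul, det_conjTranspose] at h
  exact isUnit_of_mul_isUnit_left (h ▸ hM.star.mul hM)

theorem polarUnitary_mem {M : Matrix ι ι ℂ} (hM : IsUnit M.det) :
    polarUnitary M ∈ Matrix.unitaryGroup ι ℂ := by
  have hu := isUnit_sqrt_conjTranspose_mul_self hM
  have hs := CFC.sqrt_mul_sqrt_self (Mᴴ * M) (posSemidef_conjTranspose_mul_self M).nonneg
  have hh : (CFC.sqrt (Mᴴ * M))ᴴ = CFC.sqrt (Mᴴ * M) :=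
    (CFC.sqrt_nonneg (Mᴴ * M)).posSemidef.isHermitian
  rw [mem_unitaryGroup_iff', star_eq_conjTranspose, polarUnitary, conjTranspose_mul,
    conjTranspose_nonsing_inv, hh, Matrix.mul_assoc, ← Matrix.mul_assoc Mᴴ]
  nth_rewrite 2 [← hs]
  rw [Matrix.mul_assoc, Matrix.mul_nonsing_inv _ hu, Matrix.mul_one, Matrix.nonsing_inv_mul _ hu]

theorem polarUnitary_of_mem {M : Matrix ι ι ℂ} (hM : M ∈ Matrix.unitaryGroup ι ℂ) :
    polarUnitary M = M := by
  rw [mem_unitaryGroup_iff', star_eq_conjTranspose] at hM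
  rw [polarUnitary, hM, CFC.sqrt_one, inv_one, Matrix.mul_one]

/-- Entrywise conjugation is multiplicative and preserves positivity, so uniqueness of positive
square roots makes it commute with `CFC.sqrt`. -/
theorem polarUnitary_map_star {M : Matrix ι ι ℂ} (hM : IsUnit M.det) :
    polarUnitary (M.map star) = (polarUnitary M).map star := by
  have hmul (A B : Matrix ι ι ℂ) : (A * B).map star = A.map star * B.map star :=
    Matrix.map_mul (f := starRingEnd ℂ)
  have hs : CFC.sqrt ((M.map star)ᴴ * M.map star) = (CFC.sqrt (Mᴴ * M)).map star := by
    refine CFC.sqrt_unique ?_ ?_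
    · rw [← hmul, CFC.sqrt_mul_sqrt_self _ (posSemidef_conjTranspose_mul_self M).nonneg, hmul]
      rfl
    · have := (CFC.sqrt_nonneg (Mᴴ * M)).posSemidef
      -- For a Hermitian matrix the entrywise conjugate is the transpose, which is again positive.
      rw [← Matrix.conjTranspose_transpose, this.isHermitian.eq]
      exact this.transpose.nonneg
  have hinv : ((CFC.sqrt (Mᴴ * M)).map star)⁻¹ = ((CFC.sqrt (Mᴴ * M))⁻¹).map star := by
    refine Matrix.inv_eq_left_inv ?_
    rw [← hmul, Matrix.nonsing_inv_mul _ (isUnit_sqrt_conjTranspose_mul_self hM)]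
    ext i j
    simp [Matrix.one_apply, apply_ite]
  rw [polarUnitary, polarUnitary, hs, hinv, hmul]

theorem continuousOn_sqrt_matrix :
    ContinuousOn (CFC.sqrt : Matrix ι ι ℂ → Matrix ι ι ℂ) {M | 0 ≤ M} :=
  CFC.continuousOn_sqrt

theorem continuousOn_polarUnitary :
    ContinuousOn (polarUnitary : Matrix ι ι ℂ → Matrix ι ι ℂ) {M | IsUnit M.det} := by
  intro M hM
  have hs : ContinuousWithinAt (fun M : Matrix ι ι ℂ => CFC.sqrt (Mᴴ * M)) {M | IsUnit M.det} M :=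
    (continuousOn_sqrt_matrix (Mᴴ * M) (posSemidef_conjTranspose_mul_self M).nonneg).comp
      (t := {M | 0 ≤ M}) (f := fun M : Matrix ι ι ℂ => Mᴴ * M)
      (by fun_prop) (fun N _ => (posSemidef_conjTranspose_mul_self N).nonneg)
  refine continuousWithinAt_id.mul ?_
  have hu := isUnit_sqrt_conjTranspose_mul_self hM
  refine ContinuousAt.comp_continuousWithinAt (g := fun A : Matrix ι ι ℂ => A⁻¹) ?_ hs
  refine continuousAt_matrix_inv _ ?_
  rw [Ring.inverse_eq_inv']
  exact continuousAt_inv₀ hu.ne_zero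

end Polar

/-! ### The symmetry conditions in matrix form -/

section Matrices

open Matrix

variable {H : Type*} [NormedAddCommGroup H] [InnerProductSpace ℂ H]
variable {n : ℕ} (b : OrthonormalBasis (Fin n ⊕ Fin n) ℂ H)

theorem matrixIn_apply (A : H →L[ℂ] H) (i j : Fin n ⊕ Fin n) :
    matrixIn b A i j = b.repr (A (b j)) i := by
  simp [matrixIn, LinearMap.toMatrix_apply]

theorem repr_apply_eq_sum (A : H →L[ℂ] H) (x : H) (i : Fin n ⊕ Fin n) :
    b.repr (A x) i = ∑ j, matrixIn b A i j * b.repr x j := by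
  have := congrFun (LinearMap.toMatrix_mulVec_repr b.toBasis b.toBasis (A : H →ₗ[ℂ] H) x) i
  simpa [mulVec, dotProduct, matrixIn] using this.symm

theorem repr_semilinear_apply (J : H ≃ₗᵢ⋆[ℂ] H) (s : Fin n ⊕ Fin n → ℂ)
    (hJ : ∀ i, J (b i) = s i • b i) (x : H) (i : Fin n ⊕ Fin n) :
    b.repr (J x) i = s i * star (b.repr x i) := by
  conv_lhs => rw [← b.sum_repr x]
  simp only [map_sum, map_smulₛₗ, hJ, WithLp.ofLp_sum, Finset.sum_apply,
    PiLp.smul_apply, b.repr_self, PiLp.single_apply, smul_eq_mul, starRingEnd_apply]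
  simp [mul_comm]

/-- In coordinates `J` is complex conjugation followed by `diag(s)`, so conjugating by `J` acts
entry by entry. -/
theorem conj_eq_iff_matrixIn (J : H ≃ₗᵢ⋆[ℂ] H) (s : Fin n ⊕ Fin n → ℂ)
    (hJ : ∀ i, J (b i) = s i • b i) (A B : H →L[ℂ] H) :
    (∀ x, J.symm (A (J x)) = B x) ↔
      ∀ i j, matrixIn b A i j * s j = s i * star (matrixIn b B i j) := by
  have h1 : (∀ x, J.symm (A (J x)) = B x) ↔ ∀ x, A (J x) = J (B x) :=
    forall_congr' fun x => by rw [LinearIsometryEquiv.symm_apply_eq]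
  rw [h1]
  constructor
  · intro h i j
    have := congrArg (fun y => b.repr y i) (h (b j))
    simpa only [repr_semilinear_apply b J s hJ, ← matrixIn_apply, hJ, map_smul,
      PiLp.smul_apply, smul_eq_mul, mul_comm (s j)] using this
  · intro h x
    refine b.repr.injective (PiLp.ext fun i => ?_)
    rw [repr_semilinear_apply b J s hJ, repr_apply_eq_sum, repr_apply_eq_sum, star_sum,
      Finset.mul_sum]
    refine Finset.sum_congr rfl fun j _ => ?_
    rw [repr_semilinear_apply b J s hJ, ← mul_assoc, h, star_mul', mul_assoc]

theorem matrixIn_injective : Function.Injective (matrixIn b) := fun A B h => by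
  ext x
  refine b.repr.injective (PiLp.ext fun i => ?_)
  rw [repr_apply_eq_sum, repr_apply_eq_sum, h]

theorem matrixIn_comp (A B : H →L[ℂ] H) : matrixIn b (A ∘L B) = matrixIn b A * matrixIn b B :=
  LinearMap.toMatrix_comp _ _ _ _ _

theorem matrixIn_one_sub (A : H →L[ℂ] H) :
    matrixIn b (ContinuousLinearMap.id ℂ H - A) = 1 - matrixIn b A := by
  ext i j
  simp [matrixIn_apply, one_apply]

theorem symmetric_iff_matrixIn (A : H →L[ℂ] H) :
    (∀ x y : H, inner ℂ (A x) y = inner ℂ x (A y)) ↔ (matrixIn b A)ᴴ = matrixIn b A := by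
  constructor
  · intro h
    ext i j
    rw [conjTranspose_apply, matrixIn_apply, matrixIn_apply, b.repr_apply_apply,
      b.repr_apply_apply, ← h]
    exact inner_conj_symm _ _
  · intro h x y
    rw [← b.repr.inner_map_map, ← b.repr.inner_map_map x, PiLp.inner_apply, PiLp.inner_apply]
    simp_rw [repr_apply_eq_sum, RCLike.inner_apply, map_sum, Finset.mul_sum, Finset.sum_mul]
    rw [Finset.sum_comm]
    refine Finset.sum_congr rfl fun i _ => Finset.sum_congr rfl fun j _ => ?_
    have hji := congrFun (congrFun h i) j
    rw [conjTranspose_apply] at hji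
    rw [← hji, map_mul, starRingEnd_apply (matrixIn b A j i)]
    ring

theorem mem_grassmannian_iff (A : H →L[ℂ] H) (m : ℕ) :
    A ∈ grassmannian H m ↔ matrixIn b A * matrixIn b A = matrixIn b A ∧
      (matrixIn b A)ᴴ = matrixIn b A ∧ (matrixIn b A).trace = m := by
  rw [grassmannian, Set.mem_ofPred_eq, ← matrixIn_comp, (matrixIn_injective b).eq_iff,
    symmetric_iff_matrixIn b, LinearMap.trace_eq_matrix_trace ℂ b.toBasis]
  rfl

theorem blockQ_apply (A : H →L[ℂ] H) (i j : Fin n) :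
    blockQ b A i j = 2 * matrixIn b A (Sum.inl i) (Sum.inr j) := rfl

/-- The matrix `½ [[1, Q], [Q*, 1]]`. -/
noncomputable def chiralProjection (Q : Matrix (Fin n) (Fin n) ℂ) :
    Matrix (Fin n ⊕ Fin n) (Fin n ⊕ Fin n) ℂ :=
  (1 / 2 : ℂ) • fromBlocks 1 Q Qᴴ 1

/-- The off-diagonal blocks of the square agree automatically; the diagonal ones say `Q Q* = 1` and
`Q* Q = 1`, equivalent for square matrices. -/
theorem chiralProjection_mul_self_iff (Q : Matrix (Fin n) (Fin n) ℂ) :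
    chiralProjection Q * chiralProjection Q = chiralProjection Q ↔
      Q ∈ unitaryGroup (Fin n) ℂ := by
  have h (X : Matrix (Fin n) (Fin n) ℂ) : (1 / 2 : ℂ) • (1 + X) = 1 ↔ X = 1 := by
    constructor
    · intro h
      have : X = (2 : ℂ) • ((1 / 2 : ℂ) • (1 + X)) - 1 := by
        rw [smul_smul]; norm_num
      rw [this, h, two_smul, add_sub_cancel_right]
    · rintro rfl
      rw [← two_smul ℂ (1 : Matrix (Fin n) (Fin n) ℂ), smul_smul]
      norm_num
  have h' (X : Matrix (Fin n) (Fin n) ℂ) : (1 / 2 : ℂ) • (X + X) = X := by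
    rw [← two_smul ℂ X, smul_smul]; norm_num
  rw [chiralProjection, smul_mul, Matrix.mul_smul,
    (smul_right_injective _ (by norm_num : (1 / 2 : ℂ) ≠ 0)).eq_iff, fromBlocks_multiply,
    fromBlocks_smul, fromBlocks_inj]
  simp only [Matrix.one_mul, Matrix.mul_one, h', h, true_and]
  rw [add_comm (Qᴴ * Q), h, mem_unitaryGroup_iff, star_eq_conjTranspose]
  exact ⟨fun h => h.1, fun h => ⟨h, mul_eq_one_comm.1 h⟩⟩

theorem conjTranspose_chiralProjection (Q : Matrix (Fin n) (Fin n) ℂ) :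
    (chiralProjection Q)ᴴ = chiralProjection Q := by
  rw [chiralProjection, conjTranspose_smul, fromBlocks_conjTranspose]
  simp

theorem trace_chiralProjection (Q : Matrix (Fin n) (Fin n) ℂ) :
    (chiralProjection Q).trace = n := by
  rw [chiralProjection, trace_smul, trace, Fintype.sum_sum_type]
  simp
  ring

theorem mem_grassmannian_of_matrixIn_eq {A : H →L[ℂ] H} {Q : Matrix (Fin n) (Fin n) ℂ}
    (h : matrixIn b A = chiralProjection Q) :
    A ∈ grassmannian H n ↔ Q ∈ unitaryGroup (Fin n) ℂ := by
  simp [mem_grassmannian_iff b, h, chiralProjection_mul_self_iff, conjTranspose_chiralProjection,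
    trace_chiralProjection]

theorem blockQ_of_matrixIn_eq {A : H →L[ℂ] H} {Q : Matrix (Fin n) (Fin n) ℂ}
    (h : matrixIn b A = chiralProjection Q) : blockQ b A = Q := by
  ext i j
  rw [blockQ_apply, h]
  simp [chiralProjection]

variable {b} in
-- The `T` condition identifies the matrix at `k` with the conjugate of the one at `-k`. Substituted
-- in the `C` condition, it forces each diagonal block to equal `1` minus itself, hence `½`;
-- self-adjointness determines the lower left block.
theorem IsNormalFormBasis.mem_BDI_iff {σ : BDISymmetry H} (hb : IsNormalFormBasis σ b) {d : ℕ}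
    (P : C(Torus d, H →L[ℂ] H)) :
    P ∈ BDI σ d n ↔ ∀ k, blockQ b (P k) ∈ unitaryGroup (Fin n) ℂ ∧
      matrixIn b (P k) = chiralProjection (blockQ b (P k)) ∧
      blockQ b (P (-k)) = (blockQ b (P k)).map star := by
  have hT (k : Torus d) : (∀ x, σ.T.symm (P k (σ.T x)) = P (-k) x) ↔
      ∀ i j, matrixIn b (P k) i j = star (matrixIn b (P (-k)) i j) := by
    rw [conj_eq_iff_matrixIn b σ.T (fun _ => 1) (by simp [hb.T_apply])]
    simp
  have hC (k : Torus d) : (∀ x, σ.C.symm (P k (σ.C x)) = x - P (-k) x) ↔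
      ∀ i j, matrixIn b (P k) i j * (Sum.elim 1 (-1) j : ℂ) =
        (Sum.elim 1 (-1) i : ℂ) * star ((1 - matrixIn b (P (-k))) i j) := by
    rw [← matrixIn_one_sub, ← conj_eq_iff_matrixIn b σ.C _ (by rintro (i | i) <;>
      simp [hb.C_inl, hb.C_inr])]
    rfl
  rw [BDI, Set.mem_ofPred_eq]
  simp_rw [hT, hC]
  rw [← forall_and, ← forall_and]
  constructor
  · intro h k
    obtain ⟨hG, hTk, hCk⟩ := h k
    have hadj := ((mem_grassmannian_iff b _ _).1 hG).2.1
    have hM : matrixIn b (P k) = chiralProjection (blockQ b (P k)) := by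
      rw [chiralProjection]
      ext (i | i) (j | j)
      · have h1 := hCk (Sum.inl i) (Sum.inl j)
        rw [Matrix.sub_apply, star_sub, ← hTk] at h1
        by_cases hij : i = j <;> simp [one_apply, hij] at h1 ⊢ <;> linear_combination (1 / 2 : ℂ) * h1
      · simp [blockQ_apply]
      · simpa [blockQ_apply] using (congrFun (congrFun hadj (Sum.inr i)) (Sum.inl j)).symm
      · have h1 := hCk (Sum.inr i) (Sum.inr j)
        rw [Matrix.sub_apply, star_sub, ← hTk] at h1
        by_cases hij : i = j <;> simp [one_apply, hij] at h1 ⊢ <;> linear_combination (-1 / 2 : ℂ) * h1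
    refine ⟨(mem_grassmannian_of_matrixIn_eq b hM).1 hG, hM, ?_⟩
    ext i j
    rw [blockQ_apply, map_apply, blockQ_apply, hTk]
    simp
  · intro h k
    obtain ⟨hU, hM, hk⟩ := h k
    have hM' := (h (-k)).2.1
    refine ⟨(mem_grassmannian_of_matrixIn_eq b hM).2 hU, ?_, ?_⟩ <;> rw [hM', hM, hk] <;>
      rintro (i | i) (j | j) <;> by_cases hij : i = j <;>
      simp [chiralProjection, hij]
    all_goals norm_num

end Matrices

/-! ### Antiunitary involutions, the dimension count and the normal form -/

section NormalForm

open Matrix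

variable {H : Type*} [NormedAddCommGroup H] [InnerProductSpace ℂ H]

/-- Polarization: `T` preserves norms and sends `i y` to `-i T y`, which exchanges the roles of the
two arguments in the imaginary part. -/
theorem inner_antiunitary (T : H ≃ₗᵢ⋆[ℂ] H) (x y : H) :
    inner ℂ (T x) (T y) = inner ℂ y x := by
  have hI : T (Complex.I • y) = -(Complex.I • T y) := by
    rw [map_smulₛₗ]; simp
  rw [inner_eq_sum_norm_sq_div_four (𝕜 := ℂ) (T x), inner_eq_sum_norm_sq_div_four (𝕜 := ℂ) y]
  have h1 : ‖T x + T y‖ = ‖y + x‖ := by rw [← map_add, T.norm_map, add_comm]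
  have h2 : ‖T x - T y‖ = ‖y - x‖ := by rw [← map_sub, T.norm_map, norm_sub_rev]
  have h3 : ‖T x - Complex.I • T y‖ = ‖y - Complex.I • x‖ := by
    rw [sub_eq_add_neg, ← hI, ← map_add, T.norm_map]
    have : y - Complex.I • x = -Complex.I • (x + Complex.I • y) := by
      rw [smul_add, smul_smul]; simp [sub_eq_add_neg, add_comm]
    rw [this, norm_smul]
    simp
  have h4 : ‖T x + Complex.I • T y‖ = ‖y + Complex.I • x‖ := by
    have h : Complex.I • T y = T (-(Complex.I • y)) := by rw [map_neg, hI, neg_neg]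
    rw [h, ← map_add, T.norm_map]
    have : y + Complex.I • x = Complex.I • (x + -(Complex.I • y)) := by
      rw [smul_add, smul_neg, smul_smul]; simp [add_comm]
    rw [this, norm_smul]
    simp
  rw [h1, h2]
  change ((‖y + x‖ : ℂ) ^ 2 - (‖y - x‖ : ℂ) ^ 2 +
    ((‖T x - Complex.I • T y‖ : ℂ) ^ 2 - (‖T x + Complex.I • T y‖ : ℂ) ^ 2) * Complex.I) / 4 =
    ((‖y + x‖ : ℂ) ^ 2 - (‖y - x‖ : ℂ) ^ 2 +
    ((‖y - Complex.I • x‖ : ℂ) ^ 2 - (‖y + Complex.I • x‖ : ℂ) ^ 2) * Complex.I) / 4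
  rw [h3, h4]

theorem Orthonormal.map_antiunitary {ι : Type*} {u : ι → H} (hu : Orthonormal ℂ u)
    (T : H ≃ₗᵢ⋆[ℂ] H) : Orthonormal ℂ fun i => T (u i) := by
  classical
  rw [orthonormal_iff_ite] at hu ⊢
  intro i j
  rw [inner_antiunitary, hu]
  simp [eq_comm]

theorem Orthonormal.card_le_finrank_of_mem [FiniteDimensional ℂ H] {m : ℕ} {u : Fin m → H}
    (hu : Orthonormal ℂ u) {W : Submodule ℂ H} (hW : ∀ i, u i ∈ W) :
    m ≤ Module.finrank ℂ W := by
  have h := finrank_span_eq_card hu.linearIndependent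
  rw [Fintype.card_fin] at h
  rw [← h]
  exact Submodule.finrank_mono (Submodule.span_le.2 (by rintro _ ⟨i, rfl⟩; exact hW i))

/-- A subspace invariant under an antiunitary involution has orthonormal families of fixed
vectors of any size up to its dimension. -/
theorem exists_orthonormal_fixed [FiniteDimensional ℂ H] (T : H ≃ₗᵢ⋆[ℂ] H)
    (hT : ∀ x, T (T x) = x) (W : Submodule ℂ H) (hW : ∀ x ∈ W, T x ∈ W) :
    ∀ m ≤ Module.finrank ℂ W,
      ∃ u : Fin m → H, Orthonormal ℂ u ∧ ∀ i, T (u i) = u i ∧ u i ∈ W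
  | 0, _ => ⟨Fin.elim0, ⟨fun i => i.elim0, fun i => i.elim0⟩, fun i => i.elim0⟩
  | m + 1, hm => by
    obtain ⟨u, hu, hfix⟩ := exists_orthonormal_fixed T hT W hW m (Nat.le_of_succ_le hm)
    obtain ⟨w, hwW, hw⟩ : ∃ w ∈ W, w ∉ Submodule.span ℂ (Set.range u) := by
      by_contra! h
      have := Submodule.finrank_mono (show W ≤ Submodule.span ℂ (Set.range u) from h)
      rw [finrank_span_eq_card hu.linearIndependent, Fintype.card_fin] at this
      omega
    set p := ∑ j, inner ℂ (u j) w • u j with hp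
    set y := w - p with hy
    have hyW : y ∈ W := W.sub_mem hwW (W.sum_mem fun j _ => W.smul_mem _ (hfix j).2)
    have hy0 : y ≠ 0 := fun h => hw (by
      rw [sub_eq_zero.1 h]
      exact Submodule.sum_mem _ fun j _ => Submodule.smul_mem _ _ (Submodule.subset_span ⟨j, rfl⟩))
    have hyu (i) : inner ℂ (u i) y = 0 := by
      rw [hy, inner_sub_right, hp, hu.inner_right_fintype, sub_self]
    have hTyu (i) : inner ℂ (u i) (T y) = 0 := by
      rw [← (hfix i).1, inner_antiunitary, ← inner_conj_symm, hyu, map_zero]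
    -- `y + T y` is fixed by `T`; if it vanishes then `T y = -y`, and antilinearity makes `i y`
    -- fixed instead.
    obtain ⟨z, hzW, hz0, hTz, hzu⟩ :
        ∃ z ∈ W, z ≠ 0 ∧ T z = z ∧ ∀ i, inner ℂ (u i) z = 0 := by
      by_cases h : y + T y = 0
      · refine ⟨Complex.I • y, W.smul_mem _ hyW, smul_ne_zero Complex.I_ne_zero hy0, ?_, fun i => ?_⟩
        · rw [map_smulₛₗ, eq_neg_of_add_eq_zero_right h]; simp
        · rw [inner_smul_right, hyu, mul_zero]
      · exact ⟨y + T y, W.add_mem hyW (hW y hyW), h, by rw [map_add, hT, add_comm],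
          fun i => by rw [inner_add_right, hyu, hTyu, add_zero]⟩
    set c : ℂ := ((‖z‖⁻¹ : ℝ) : ℂ) with hc
    refine ⟨Fin.cons (c • z) u, ⟨fun i => ?_, fun i j => ?_⟩, fun i => ?_⟩
    · refine Fin.cases ?_ (fun i => ?_) i
      · simp [hc, norm_smul, hz0]
      · simpa using hu.1 i
    · refine Fin.cases ?_ (fun i => ?_) i <;> refine Fin.cases ?_ (fun j => ?_) j <;> intro hij
      · exact absurd rfl hij
      · simp only [Fin.cons_zero, Fin.cons_succ]
        rw [inner_smul_left, ← inner_conj_symm, hzu, map_zero, mul_zero]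
      · simp only [Fin.cons_zero, Fin.cons_succ]
        rw [inner_smul_right, hzu, mul_zero]
      · simpa using hu.2 (fun h => hij (by rw [h]))
    · refine Fin.cases ⟨?_, W.smul_mem _ hzW⟩ (fun i => hfix i) i
      simp only [Fin.cons_zero]
      rw [map_smulₛₗ, hTz, hc, Complex.conj_ofReal]

theorem BDISymmetry.commute (σ : BDISymmetry H) (x : H) : σ.T (σ.C x) = σ.C (σ.T x) := by
  have := σ.S_sq (σ.C (σ.T x))
  rwa [σ.C_even, σ.T_even] at this

/-- The properties of the value at the origin of an element of `BDI`. -/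
theorem exists_projection_of_nonempty {σ : BDISymmetry H} {d n : ℕ} (h : (BDI σ d n).Nonempty) :
    ∃ A : H →L[ℂ] H, A ∈ grassmannian H n ∧ (∀ x, A (σ.T x) = σ.T (A x)) ∧
      ∀ x, A (σ.C x) = σ.C (x - A x) := by
  obtain ⟨P, hG, hT, hC⟩ := h
  refine ⟨P 0, hG 0, fun x => ?_, fun x => ?_⟩
  · rw [← LinearIsometryEquiv.symm_apply_eq, hT, neg_zero]
  · rw [← LinearIsometryEquiv.symm_apply_eq, hC, neg_zero]

section

variable [FiniteDimensional ℂ H]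

theorem finrank_range_of_mem_grassmannian {A : H →L[ℂ] H} {n : ℕ} (hA : A ∈ grassmannian H n) :
    Module.finrank ℂ (LinearMap.range (A : H →ₗ[ℂ] H)) = n := by
  have hi : IsIdempotentElem (A : H →ₗ[ℂ] H) := by
    ext x
    exact congrArg (fun B : H →L[ℂ] H => B x) hA.1
  have := (LinearMap.IsIdempotentElem.isProj_range _ hi).trace
  rw [hA.2.2] at this
  exact_mod_cast this.symm

variable {σ : BDISymmetry H} {n : ℕ} {A : H →L[ℂ] H}

theorem exists_orthonormal_range (hA : A ∈ grassmannian H n)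
    (hT : ∀ x, A (σ.T x) = σ.T (A x)) :
    ∃ u : Fin n → H, Orthonormal ℂ u ∧ ∀ i, σ.T (u i) = u i ∧ A (u i) = u i := by
  obtain ⟨u, hu, h⟩ := exists_orthonormal_fixed σ.T σ.T_even (LinearMap.range (A : H →ₗ[ℂ] H))
    (by rintro _ ⟨x, rfl⟩; exact ⟨σ.T x, hT x⟩) n (finrank_range_of_mem_grassmannian hA).ge
  refine ⟨u, hu, fun i => ⟨(h i).1, ?_⟩⟩
  obtain ⟨x, hx⟩ := (h i).2
  rw [← hx]
  exact congrArg (fun B : H →L[ℂ] H => B x) hA.1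

/-- `C` exchanges the range and the kernel of `A`. It carries orthonormal families to orthonormal
families, so each space has at least the dimension of the other. -/
theorem finrank_eq_two_mul (hA : A ∈ grassmannian H n)
    (hT : ∀ x, A (σ.T x) = σ.T (A x)) (hC : ∀ x, A (σ.C x) = σ.C (x - A x)) :
    Module.finrank ℂ H = 2 * n := by
  have hr := finrank_range_of_mem_grassmannian hA
  have hrk := LinearMap.finrank_range_add_finrank_ker (A : H →ₗ[ℂ] H)
  obtain ⟨u, hu, h⟩ := exists_orthonormal_range hA hT
  obtain ⟨v, hv, h'⟩ := exists_orthonormal_fixed σ.T σ.T_even (LinearMap.ker (A : H →ₗ[ℂ] H))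
    (fun x hx => by
      rw [LinearMap.mem_ker] at hx ⊢
      change A (σ.T x) = 0
      rw [hT, show A x = 0 from hx, map_zero]) _ le_rfl
  have h1 := (hu.map_antiunitary σ.C).card_le_finrank_of_mem
    (W := LinearMap.ker (A : H →ₗ[ℂ] H)) (fun i => by
      change A (σ.C (u i)) = 0
      rw [hC, (h i).2, sub_self, map_zero])
  have h2 := (hv.map_antiunitary σ.C).card_le_finrank_of_mem
    (W := LinearMap.range (A : H →ₗ[ℂ] H)) (fun i => ⟨σ.C (v i), by
      change A (σ.C (v i)) = σ.C (v i)
      rw [hC, show A (v i) = 0 from (h' i).2, sub_zero]⟩)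
  omega

/-- Take a `T`-fixed orthonormal basis `u` of the range. The vectors `C u` lie in the kernel, and
`(u ± C u)/√2` are eigenvectors of `C` for `±1`; they stay `T`-fixed because `T` and `C` commute. -/
theorem exists_isNormalFormBasis (hA : A ∈ grassmannian H n)
    (hT : ∀ x, A (σ.T x) = σ.T (A x)) (hC : ∀ x, A (σ.C x) = σ.C (x - A x)) :
    ∃ b : OrthonormalBasis (Fin n ⊕ Fin n) ℂ H, IsNormalFormBasis σ b := by
  obtain ⟨u, hu, h⟩ := exists_orthonormal_range hA hT
  have hN := finrank_eq_two_mul hA hT hC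
  set c : ℂ := (((√2)⁻¹ : ℝ) : ℂ) with hc
  have hcc : c * c = 1 / 2 := by
    rw [hc, ← Complex.ofReal_mul, ← mul_inv, Real.mul_self_sqrt (by norm_num)]
    norm_num
  have hcs : starRingEnd ℂ c = c := Complex.conj_ofReal _
  have hCu := hu.map_antiunitary σ.C
  -- Range and kernel of a self-adjoint projection are orthogonal: `A` fixes `u i` and kills `C (u
  -- j)`.
  have huC (i j) : inner ℂ (u i) (σ.C (u j)) = 0 := by
    rw [← (h i).2, hA.2.1, hC, (h j).2, sub_self, map_zero, inner_zero_right]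
  have hCu' (i j) : inner ℂ (σ.C (u i)) (u j) = 0 := by
    rw [← inner_conj_symm, huC, map_zero]
  let f : Fin n ⊕ Fin n → H :=
    Sum.elim (fun j => c • (u j + σ.C (u j))) (fun j => c • (u j - σ.C (u j)))
  have hf : Orthonormal ℂ f := by
    rw [orthonormal_iff_ite] at hu hCu ⊢
    rintro (i | i) (j | j) <;>
      simp only [f, Sum.elim_inl, Sum.elim_inr, inner_smul_left, inner_smul_right, inner_add_left,
        inner_add_right, inner_sub_left, inner_sub_right, hu, hCu, huC, hCu', hcs, Sum.inl.injEq,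
        Sum.inr.injEq, reduceCtorEq, if_false] <;>
      split_ifs <;> first | linear_combination 2 * hcc | ring
  have hspan : ⊤ ≤ Submodule.span ℂ (Set.range f) :=
    (hf.linearIndependent.span_eq_top_of_card_eq_finrank' (by simp [hN, two_mul])).ge
  refine ⟨OrthonormalBasis.mk hf hspan, ⟨?_, ?_, ?_⟩⟩
  · rintro (i | i) <;> simp [f, hcs, σ.commute, (h i).1, map_smulₛₗ]
  · intro i
    simp [f, hcs, σ.C_even, map_smulₛₗ, add_comm]
  · intro i
    simp only [f, OrthonormalBasis.coe_mk, Sum.elim_inr, map_smulₛₗ, hcs, map_sub, σ.C_even]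
    rw [← smul_neg, neg_sub]

end

/-- The antiunitary operator acting as `b i ↦ s i • b i`, for signs `s`. -/
noncomputable def signedConj {ι : Type*} [Fintype ι] (b : OrthonormalBasis ι ℂ H) (s : ι → ℤˣ) :
    H ≃ₗᵢ⋆[ℂ] H where
  toLinearEquiv := LinearEquiv.ofInvolutive
    { toFun := fun x => b.repr.symm (WithLp.toLp 2 fun i => ((s i : ℤ) : ℂ) * star (b.repr x i))
      map_add' := fun x y => by
        rw [← map_add]
        congr 1
        ext i
        simp [mul_add]
      map_smul' := fun a x => by
        rw [← map_smul]
        congr 1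
        ext i
        simp
        ring }
    (fun x => by
      refine b.repr.injective (PiLp.ext fun i => ?_)
      have : ((s i : ℤ) : ℂ) * ((s i : ℤ) : ℂ) = 1 := by
        rcases Int.units_eq_one_or (s i) with h | h <;> simp [h]
      simp [← mul_assoc, this])
  norm_map' x := by
    change ‖b.repr.symm _‖ = ‖x‖
    rw [LinearIsometryEquiv.norm_map, ← b.repr.norm_map, EuclideanSpace.norm_eq,
      EuclideanSpace.norm_eq]
    congr 1
    refine Finset.sum_congr rfl fun i _ => ?_
    rcases Int.units_eq_one_or (s i) with h | h <;> simp [h]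

theorem repr_signedConj {ι : Type*} [Fintype ι] (b : OrthonormalBasis ι ℂ H) (s : ι → ℤˣ) (x : H)
    (i : ι) : b.repr (signedConj b s x) i = ((s i : ℤ) : ℂ) * star (b.repr x i) := by
  change b.repr (b.repr.symm _) i = _
  simp

theorem signedConj_basis {ι : Type*} [Fintype ι] [DecidableEq ι] (b : OrthonormalBasis ι ℂ H)
    (s : ι → ℤˣ) (i : ι) : signedConj b s (b i) = ((s i : ℤ) : ℂ) • b i := by
  refine b.repr.injective (PiLp.ext fun j => ?_)
  rw [repr_signedConj]
  by_cases h : j = i <;> simp [b.repr_self, h]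

/-- The class BDI symmetries in normal form with respect to a basis. -/
noncomputable def normalFormSymmetry {n : ℕ} (b : OrthonormalBasis (Fin n ⊕ Fin n) ℂ H) :
    BDISymmetry H where
  T := signedConj b 1
  C := signedConj b (Sum.elim 1 (-1))
  T_even x := (signedConj b 1).toLinearEquiv.symm_apply_apply x
  C_even x := (signedConj b (Sum.elim 1 (-1))).toLinearEquiv.symm_apply_apply x
  S_sq x := by
    refine b.repr.injective (PiLp.ext fun i => ?_)
    simp only [repr_signedConj]
    rcases i with i | i <;> simp

theorem isNormalFormBasis_normalFormSymmetry {n : ℕ} (b : OrthonormalBasis (Fin n ⊕ Fin n) ℂ H) :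
    IsNormalFormBasis (normalFormSymmetry b) b where
  T_apply i := by simp [normalFormSymmetry, signedConj_basis]
  C_inl i := by simp [normalFormSymmetry, signedConj_basis]
  C_inr i := by simp [normalFormSymmetry, signedConj_basis]

variable {n : ℕ} (b : OrthonormalBasis (Fin n ⊕ Fin n) ℂ H)

/-- The operator with a given matrix in an orthonormal basis. -/
noncomputable def operatorOf [FiniteDimensional ℂ H] :
    Matrix (Fin n ⊕ Fin n) (Fin n ⊕ Fin n) ℂ →ₗ[ℂ] H →L[ℂ] H :=
  LinearMap.toContinuousLinearMap.toLinearMap ∘ₗ (Matrix.toLin b.toBasis b.toBasis).toLinearMap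

theorem continuous_blockQ : Continuous (blockQ b) :=
  continuous_matrix fun i j => by
    simp_rw [blockQ_apply, matrixIn_apply, b.repr_apply_apply]
    fun_prop

variable {b} in
theorem IsNormalFormBasis.eq_of_blockQ_eq {σ : BDISymmetry H} (hb : IsNormalFormBasis σ b) {d : ℕ}
    {P P' : C(Torus d, H →L[ℂ] H)} (hP : P ∈ BDI σ d n) (hP' : P' ∈ BDI σ d n) {k : Torus d}
    (h : blockQ b (P k) = blockQ b (P' k)) : P k = P' k :=
  matrixIn_injective b (by
    rw [((hb.mem_BDI_iff P).1 hP k).2.1, ((hb.mem_BDI_iff P').1 hP' k).2.1, h])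

variable [FiniteDimensional ℂ H]

theorem matrixIn_operatorOf (M : Matrix (Fin n ⊕ Fin n) (Fin n ⊕ Fin n) ℂ) :
    matrixIn b (operatorOf b M) = M :=
  LinearMap.toMatrix_toLin _ _ M

theorem continuous_operatorOf : Continuous (operatorOf b) :=
  LinearMap.continuous_of_finiteDimensional _

theorem continuous_chiralProjection :
    Continuous (chiralProjection : Matrix (Fin n) (Fin n) ℂ → _) :=
  (Continuous.matrix_fromBlocks (A := fun _ => 1) (D := fun _ => 1) continuous_const continuous_id
    continuous_id.matrix_conjTranspose continuous_const).const_smul (1 / 2 : ℂ)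

/-- The family of projections with off-diagonal block `Q`. -/
noncomputable def projectionOf {X : Type*} [TopologicalSpace X]
    (Q : C(X, Matrix (Fin n) (Fin n) ℂ)) : C(X, H →L[ℂ] H) :=
  ⟨fun k => operatorOf b (chiralProjection (Q k)),
    (continuous_operatorOf b).comp (continuous_chiralProjection.comp Q.continuous)⟩

theorem matrixIn_projectionOf {X : Type*} [TopologicalSpace X]
    (Q : C(X, Matrix (Fin n) (Fin n) ℂ)) (k : X) :
    matrixIn b (projectionOf b Q k) = chiralProjection (Q k) :=
  matrixIn_operatorOf b _

theorem blockQ_projectionOf {X : Type*} [TopologicalSpace X]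
    (Q : C(X, Matrix (Fin n) (Fin n) ℂ)) (k : X) : blockQ b (projectionOf b Q k) = Q k :=
  blockQ_of_matrixIn_eq b (matrixIn_projectionOf b Q k)

variable {b} in
theorem IsNormalFormBasis.projectionOf_mem {σ : BDISymmetry H} (hb : IsNormalFormBasis σ b) {d : ℕ}
    {Q : C(Torus d, Matrix (Fin n) (Fin n) ℂ)} (hU : ∀ k, Q k ∈ unitaryGroup (Fin n) ℂ)
    (hQ : ∀ k, Q (-k) = (Q k).map star) : projectionOf b Q ∈ BDI σ d n :=
  (hb.mem_BDI_iff _).2 fun k => by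
    rw [matrixIn_projectionOf, blockQ_projectionOf, blockQ_projectionOf]
    exact ⟨hU k, rfl, hQ k⟩

theorem exists_nonempty_BDI_iff (d m N : ℕ) (hN : Module.finrank ℂ H = N) :
    (∃ σ : BDISymmetry H, (BDI σ d m).Nonempty) ↔ N = 2 * m := by
  constructor
  · rintro ⟨σ, h⟩
    obtain ⟨A, hA, hT, hC⟩ := exists_projection_of_nonempty h
    rw [← hN, finrank_eq_two_mul hA hT hC]
  · intro h
    let e : Fin (Module.finrank ℂ H) ≃ Fin m ⊕ Fin m :=
      (finCongr (by omega : Module.finrank ℂ H = m + m)).trans finSumFinEquiv.symm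
    let b := (stdOrthonormalBasis ℂ H).reindex e
    -- The constant block `Q = 1` is unitary and real, so it serves every `d`.
    refine ⟨normalFormSymmetry b, projectionOf b (ContinuousMap.const _ 1),
      (isNormalFormBasis_normalFormSymmetry b).projectionOf_mem (fun k => one_mem _) fun k => ?_⟩
    ext i j
    by_cases hij : i = j <;> simp [one_apply, hij]

end NormalForm

/-! ### Semi-winding numbers and paths of scalar symmetric functions -/

section Winding

open scoped ComplexConjugate

theorem torusPoint_zero : torusPoint 0 = 0 := by
  ext i; simp [torusPoint]

theorem torusPoint_neg (t : ℝ) : torusPoint (-t) = -torusPoint t := by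
  ext i; simp [torusPoint]

theorem neg_torusPoint_half : -torusPoint (1 / 2) = torusPoint (1 / 2) := by
  ext i
  rw [Pi.neg_apply, neg_eq_iff_add_eq_zero, torusPoint, ← AddCircle.coe_add]
  norm_num

theorem continuous_torusPoint : Continuous torusPoint :=
  continuous_pi fun _ => AddCircle.continuous_mk' 1

theorem im_eq_zero_of_neg_eq {d : ℕ} (f : SymmetricFunction d) {k : Torus d} (hk : -k = k) :
    (f.1 k).im = 0 := by
  have := f.2 k
  rw [hk] at this
  exact Complex.conj_eq_iff_im.1 this.symm

theorem exists_sign_eq {d : ℕ} (f : SymmetricFunction d) (hf : ‖f.1 0‖ = 1) :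
    ∃ ε : ℤˣ, ((ε : ℤ) : ℂ) = f.1 0 := by
  have him := im_eq_zero_of_neg_eq f neg_zero
  have hre : ((f.1 0).re : ℂ) = f.1 0 := Complex.ext (by simp) (by simp [him])
  rw [← hre, Complex.norm_real, Real.norm_eq_abs, abs_eq zero_le_one] at hf
  rcases hf with h | h
  · exact ⟨1, by rw [← hre, h]; simp⟩
  · exact ⟨-1, by rw [← hre, h]; simp⟩

theorem sign_eq_of_norm_sub_lt {ε ε' : ℤˣ} (h : ‖((ε : ℤ) : ℂ) - ((ε' : ℤ) : ℂ)‖ < 2) :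
    ε = ε' := by
  rcases Int.units_eq_one_or ε with rfl | rfl <;> rcases Int.units_eq_one_or ε' with rfl | rfl <;>
    first | rfl | norm_num at h

theorem sin_eq_zero_of_im_exp {x : ℝ} (h : (Complex.exp (Complex.I * x)).im = 0) :
    Real.sin x = 0 := by
  rwa [mul_comm, Complex.exp_ofReal_mul_I_im] at h

/-- A continuous phase avoiding `-1` and real at both ends does not wind. -/
theorem phase_eq_of_exp_ne_neg_one {δ : ℝ → ℝ} (hδ : ContinuousOn δ (Set.Icc 0 (1 / 2)))
    (hne : ∀ k ∈ Set.Icc (0 : ℝ) (1 / 2), Complex.exp (Complex.I * (δ k : ℂ)) ≠ -1)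
    (h0 : Real.sin (δ 0) = 0) (h1 : Real.sin (δ (1 / 2)) = 0) : δ (1 / 2) = δ 0 := by
  have hodd (m : ℤ) : Complex.exp (Complex.I * (((2 * m + 1) * Real.pi : ℝ) : ℂ)) = -1 := by
    have : Complex.I * (((2 * m + 1) * Real.pi : ℝ) : ℂ) =
        Real.pi * Complex.I + m * (2 * Real.pi * Complex.I) := by push_cast; ring
    rw [this, Complex.exp_periodic.int_mul m, Complex.exp_pi_mul_I]
  have heven {k : ℝ} (hk : k ∈ Set.Icc (0 : ℝ) (1 / 2)) (hs : Real.sin (δ k) = 0) :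
      ∃ m : ℤ, δ k = 2 * m * Real.pi := by
    obtain ⟨a, ha⟩ := Real.sin_eq_zero_iff.1 hs
    obtain ⟨m, rfl | rfl⟩ := Int.even_or_odd' a
    · exact ⟨m, by rw [← ha]; push_cast; ring⟩
    · refine absurd ?_ (hne k hk)
      rw [← ha, ← hodd m]
      push_cast
      rfl
  obtain ⟨a, ha⟩ := heven (by norm_num) h0
  obtain ⟨c, hc⟩ := heven (by norm_num) h1
  -- The end values are even multiples of `π`; were they different, the intermediate value theorem
  -- would produce an odd multiple between them, where the exponential is `-1`.
  have hsub (m : ℤ) : ((2 * m + 1) * Real.pi : ℝ) ∉ Set.uIcc (δ 0) (δ (1 / 2)) := fun hm => by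
    have hu : Set.uIcc (0 : ℝ) (1 / 2) = Set.Icc 0 (1 / 2) := Set.uIcc_of_le (by norm_num)
    obtain ⟨k, hk, hkm⟩ := intermediate_value_uIcc (by rwa [hu]) hm
    rw [hu] at hk
    exact hne k hk (by rw [hkm, hodd])
  have hpi := Real.pi_pos
  rcases lt_trichotomy a c with h | h | h
  · refine absurd (Set.mem_uIcc.2 (Or.inl ⟨?_, ?_⟩)) (hsub a)
    · rw [ha]; nlinarith
    · rw [hc]
      have : (a : ℝ) + 1 ≤ c := by exact_mod_cast h
      nlinarith
  · rw [ha, hc, h]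
  · refine absurd (Set.mem_uIcc.2 (Or.inr ⟨?_, ?_⟩)) (hsub c)
    · rw [hc]; nlinarith
    · rw [ha]
      have : (c : ℝ) + 1 ≤ a := by exact_mod_cast h
      nlinarith

/-- Unit complex numbers at distance less than `2` are not antipodal, so the difference of the two
phases avoids `-1`; reality at both ends then forces it to have no net change. -/
theorem HasSemiWinding.eq_of_norm_sub_lt {f g : ℝ → ℂ} {v w : ℤ} (hf : HasSemiWinding f v)
    (hg : HasSemiWinding g w) (hf0 : (f 0).im = 0) (hf1 : (f (1 / 2)).im = 0)
    (hg0 : (g 0).im = 0) (hg1 : (g (1 / 2)).im = 0)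
    (h : ∀ k ∈ Set.Icc (0 : ℝ) (1 / 2), ‖f k - g k‖ < 2) : v = w := by
  obtain ⟨α, hα, hfα, hv⟩ := hf
  obtain ⟨β, hβ, hgβ, hw⟩ := hg
  have m0 : (0 : ℝ) ∈ Set.Icc (0 : ℝ) (1 / 2) := by norm_num
  have m1 : (1 / 2 : ℝ) ∈ Set.Icc (0 : ℝ) (1 / 2) := by norm_num
  rw [hfα _ m0] at hf0
  rw [hfα _ m1] at hf1
  rw [hgβ _ m0] at hg0
  rw [hgβ _ m1] at hg1
  have key := phase_eq_of_exp_ne_neg_one (hα.sub hβ) (fun k hk he => by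
      have h2 := h k hk
      rw [hfα k hk, hgβ k hk] at h2
      have h3 : Complex.exp (Complex.I * (α k : ℂ)) = -Complex.exp (Complex.I * (β k : ℂ)) := by
        rw [← neg_one_mul, ← he, ← Complex.exp_add, Pi.sub_apply]
        congr 1
        push_cast
        ring
      rw [h3, ← neg_add', norm_neg, ← two_mul, norm_mul, mul_comm Complex.I,
        Complex.norm_exp_ofReal_mul_I] at h2
      norm_num at h2)
    (by simp [Real.sin_sub, sin_eq_zero_of_im_exp hf0, sin_eq_zero_of_im_exp hg0])
    (by
      rw [Pi.sub_apply, Real.sin_sub, sin_eq_zero_of_im_exp hf1, sin_eq_zero_of_im_exp hg1]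
      simp)
  simp only [Pi.sub_apply] at key
  have : (v : ℝ) = w := by
    rw [hv, hw]
    congr 1
    linarith
  exact_mod_cast this

/-- The phase comes from lifting along the covering `Circle.exp`. It is an integer multiple of `π`
at `0` and at `½` because both points are fixed by `k ↦ -k`, where `f` is real. -/
theorem exists_hasSemiWinding (f : SymmetricFunction 1) (hf : ∀ k, ‖f.1 k‖ = 1) :
    ∃ w : ℤ, HasSemiWinding (fun k => f.1 (torusPoint k)) w := by
  let γ : C(unitInterval, Circle) :=
    ⟨fun t => ⟨f.1 (torusPoint (t / 2)), mem_sphere_zero_iff_norm.2 (hf _)⟩,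
      Continuous.subtype_mk (f.1.continuous.comp (continuous_torusPoint.comp (by fun_prop))) _⟩
  obtain ⟨e, he⟩ : ∃ e, Circle.exp e = γ 0 := ⟨_, Circle.exp_arg _⟩
  obtain ⟨Γ, hΓ, -⟩ := Circle.isCoveringMap_exp.exists_path_lifts γ e he.symm
  set α : ℝ → ℝ := fun k => Γ (Set.projIcc 0 1 zero_le_one (2 * k)) with hα
  have hfα : ∀ k ∈ Set.Icc (0 : ℝ) (1 / 2),
      f.1 (torusPoint k) = Complex.exp (Complex.I * (α k : ℂ)) := fun k hk => by
    have h2 : 2 * k ∈ Set.Icc (0 : ℝ) 1 := ⟨by linarith [hk.1], by linarith [hk.2]⟩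
    have := congrArg (Subtype.val) (congrFun hΓ (Set.projIcc 0 1 zero_le_one (2 * k)))
    rw [Function.comp_apply] at this
    rw [mul_comm, hα, ← Circle.coe_exp]
    refine Eq.trans ?_ this.symm
    rw [Set.projIcc_of_mem _ h2]
    change f.1 _ = f.1 (torusPoint (2 * k / 2))
    rw [mul_div_cancel_left₀ _ two_ne_zero]
  have hsin {k : ℝ} (hk : k ∈ Set.Icc (0 : ℝ) (1 / 2)) (hn : -torusPoint k = torusPoint k) :
      ∃ m : ℤ, m * Real.pi = α k :=
    Real.sin_eq_zero_iff.1 (sin_eq_zero_of_im_exp (by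
      rw [← hfα k hk]; exact im_eq_zero_of_neg_eq f hn))
  obtain ⟨a, ha⟩ := hsin (k := 0) (by norm_num) (by rw [torusPoint_zero, neg_zero])
  obtain ⟨c, hc⟩ := hsin (k := 1 / 2) (by norm_num) neg_torusPoint_half
  refine ⟨c - a, α, ?_, hfα, ?_⟩
  · exact (Γ.continuous.comp (continuous_projIcc.comp (by fun_prop))).continuousOn
  · rw [← ha, ← hc, ← sub_mul, mul_div_cancel_right₀ _ Real.pi_ne_zero]
    push_cast
    rfl

/-- Vanishing at `0` allows the odd reflection to agree with `β` on the right half; vanishing at `½`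
makes the values at `-½` and `½` glue on the circle. -/
theorem exists_odd_extension {β : ℝ → ℝ} (hβ : ContinuousOn β (Set.Icc 0 (1 / 2)))
    (h0 : β 0 = 0) (h1 : β (1 / 2) = 0) :
    ∃ B : C(Torus 1, ℝ), (∀ k, B (-k) = -B k) ∧
      ∀ t ∈ Set.Icc (0 : ℝ) (1 / 2), B (torusPoint t) = β t := by
  set E : ℝ → ℝ := fun t => β (max t 0) - β (max (-t) 0) with hE
  have hEodd (t : ℝ) : E (-t) = -E t := by simp [hE]
  have hEpos {t : ℝ} (ht : 0 ≤ t) : E t = β t := by simp [hE, ht, h0]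
  have hEc : ContinuousOn E (Set.Icc (-(1 / 2)) (-(1 / 2) + 1)) := by
    refine ContinuousOn.sub (hβ.comp (by fun_prop) ?_) (hβ.comp (by fun_prop) ?_) <;>
      intro t ht
    · exact ⟨le_max_right _ _, max_le (by linarith [ht.2]) (by norm_num)⟩
    · exact ⟨le_max_right _ _, max_le (by linarith [ht.1]) (by norm_num)⟩
  have hEh : E (-(1 / 2)) = 0 := by rw [hEodd, hEpos (by norm_num), h1, neg_zero]
  have hEh' : E (1 / 2) = 0 := by rw [hEpos (by norm_num), h1]
  have hcont : Continuous (AddCircle.liftIco 1 (-(1 / 2) : ℝ) E) :=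
    AddCircle.liftIco_continuous (by
      rw [hEh]
      norm_num at hEh' ⊢
      exact hEh'.symm) hEc
  have hval {t : ℝ} (ht : t ∈ Set.Icc (-(1 / 2) : ℝ) (1 / 2)) :
      AddCircle.liftIco 1 (-(1 / 2) : ℝ) E (t : UnitAddCircle) = E t := by
    rcases ht.2.eq_or_lt with h | h
    · have hc : ((t : ℝ) : UnitAddCircle) = ((-(1 / 2) : ℝ) : UnitAddCircle) := by
        rw [h, ← sub_eq_zero, ← AddCircle.coe_sub]
        norm_num
      rw [hc, AddCircle.liftIco_coe_apply (by norm_num), hEh, h, hEh']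
    · exact AddCircle.liftIco_coe_apply ⟨ht.1, by linarith⟩
  refine ⟨⟨fun k => AddCircle.liftIco 1 (-(1 / 2) : ℝ) E (k 0), by fun_prop⟩, fun k => ?_,
    fun t ht => ?_⟩
  · obtain ⟨t, ht, hk⟩ : ∃ t ∈ Set.Icc (-(1 / 2) : ℝ) (1 / 2), (t : UnitAddCircle) = k 0 := by
      obtain ⟨t, ht, hk⟩ := AddCircle.coe_image_Ico_eq (1 : ℝ) (-(1 / 2)) ▸ Set.mem_univ (k 0)
      exact ⟨t, ⟨ht.1, by linarith [ht.2]⟩, hk⟩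
    simp only [ContinuousMap.coe_mk, Pi.neg_apply]
    rw [← hk, ← AddCircle.coe_neg, hval ht, hval ⟨by linarith [ht.2], by linarith [ht.1]⟩, hEodd]
  · exact (hval ⟨by linarith [ht.1], ht.2⟩).trans (hEpos ht.1)

/-- Multiplication of a symmetric function by the phase `exp (i s B)`, `B` odd. -/
noncomputable def phaseMul {d : ℕ} (f : SymmetricFunction d) (B : C(Torus d, ℝ))
    (hB : ∀ k, B (-k) = -B k) (s : ℝ) : SymmetricFunction d :=
  ⟨⟨fun k => f.1 k * Complex.exp (Complex.I * ((s * B k : ℝ) : ℂ)), by fun_prop⟩, fun k => by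
    simp only [ContinuousMap.coe_mk]
    rw [f.2, hB, map_mul, ← Complex.exp_conj, map_mul, Complex.conj_I, Complex.conj_ofReal]
    congr 2
    push_cast
    ring⟩

theorem continuous_phaseMul {d : ℕ} (f : SymmetricFunction d) (B : C(Torus d, ℝ))
    (hB : ∀ k, B (-k) = -B k) : Continuous (phaseMul f B hB) :=
  Continuous.subtype_mk (ContinuousMap.continuous_of_continuous_uncurry _ (by
    change Continuous fun p : ℝ × Torus d =>
      f.1 p.2 * Complex.exp (Complex.I * ((p.1 * B p.2 : ℝ) : ℂ))
    fun_prop)) _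

/-- Equal semi-windings make the phase difference, normalized to vanish at `0`, vanish also at `½`.
Its odd extension `B` gives the path `f · exp(i s B)`, and oddness keeps this symmetric. -/
theorem joinedIn_units_of_hasSemiWinding {f g : SymmetricFunction 1} (hf : ∀ k, f.1 k ≠ 0)
    {w : ℤ} (h0 : f.1 0 = g.1 0) (hfw : HasSemiWinding (fun k => f.1 (torusPoint k)) w)
    (hgw : HasSemiWinding (fun k => g.1 (torusPoint k)) w) :
    JoinedIn {f : SymmetricFunction 1 | IsUnit f} f g := by
  obtain ⟨α, hα, hfα, hv⟩ := hfw
  obtain ⟨β, hβ, hgβ, hw⟩ := hgw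
  have hπ : (α (1 / 2) - α 0) = (β (1 / 2) - β 0) := by
    have := hv.symm.trans hw
    rwa [div_left_inj' Real.pi_ne_zero] at this
  obtain ⟨B, hB, hBβ⟩ := exists_odd_extension
    (β := fun t => (β t - α t) - (β 0 - α 0)) ((hβ.sub hα).sub continuousOn_const) (by simp)
    (by linarith)
  have hpos (t : ℝ) (ht : t ∈ Set.Icc (0 : ℝ) (1 / 2)) :
      f.1 (torusPoint t) * Complex.exp (Complex.I * (B (torusPoint t) : ℂ)) =
        g.1 (torusPoint t) := by
    have m0 : (0 : ℝ) ∈ Set.Icc (0 : ℝ) (1 / 2) := by norm_num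
    have hf0 := hfα 0 m0
    have hg0 := hgβ 0 m0
    simp only [torusPoint_zero] at hf0 hg0
    have h1 : Complex.exp (Complex.I * (α 0 : ℂ)) = Complex.exp (Complex.I * (β 0 : ℂ)) := by
      rw [← hf0, ← hg0, h0]
    have hft := hfα t ht
    have hgt := hgβ t ht
    rw [hBβ t ht]
    refine Eq.trans (congrArg (· * _) hft) (Eq.trans ?_ hgt.symm)
    rw [← Complex.exp_add]
    -- The starting phases `α 0` and `β 0` need not be equal, only their exponentials; multiplying
    -- both sides by this common value absorbs the discrepancy.
    refine mul_right_cancel₀ (Complex.exp_ne_zero (Complex.I * (β 0 : ℂ))) ?_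
    nth_rewrite 2 [← h1]
    rw [← Complex.exp_add, ← Complex.exp_add]
    congr 1
    push_cast
    ring
  have hall (k : Torus 1) : f.1 k * Complex.exp (Complex.I * (B k : ℂ)) = g.1 k := by
    obtain ⟨t, ht, hk⟩ := AddCircle.coe_image_Ico_eq (1 : ℝ) (-(1 / 2)) ▸ Set.mem_univ (k 0)
    have hk' : torusPoint t = k := by
      ext i
      rw [Subsingleton.elim i 0]
      exact hk
    rcases le_total 0 t with h | h
    · rw [← hk']
      exact hpos t ⟨h, by linarith [ht.2]⟩
    -- On the other half circle the identity is the conjugate of the one at `-t`.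
    · have h2 := congrArg conj (hpos (-t) ⟨by linarith, by linarith [ht.1]⟩)
      rw [map_mul, ← Complex.exp_conj, map_mul, Complex.conj_I, Complex.conj_ofReal, ← f.2,
        ← g.2, torusPoint_neg, neg_neg, hk', hB] at h2
      rw [← h2]
      push_cast
      ring_nf
  have h := joinedIn_of_continuous (s := {f : SymmetricFunction 1 | IsUnit f})
    (phaseMul f B hB) (continuous_phaseMul f B hB) fun s =>
      isUnit_symmetricFunctions fun k => mul_ne_zero (hf k) (Complex.exp_ne_zero _)
  convert h using 1
  · refine Subtype.ext (ContinuousMap.ext fun k => ?_)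
    simp [phaseMul]
  · refine Subtype.ext (ContinuousMap.ext fun k => ?_)
    simpa [phaseMul] using (hall k).symm

end Winding

/-! ### Homotopy classification by the determinant -/

section Classification

open Matrix
open scoped ComplexConjugate

variable {H : Type*} [NormedAddCommGroup H] [InnerProductSpace ℂ H]
variable {n d : ℕ} {b : OrthonormalBasis (Fin n ⊕ Fin n) ℂ H} {σ : BDISymmetry H}

/-- The off-diagonal block as a matrix of symmetric functions. -/
noncomputable def symbol (hb : IsNormalFormBasis σ b) (P : BDI σ d n) :
    Matrix (Fin n) (Fin n) (SymmetricFunction d) := fun i j =>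
  ⟨⟨fun k => blockQ b (P.1 k) i j,
    ((continuous_blockQ b).comp P.1.continuous).matrix_elem i j⟩, fun k =>
    congrFun (congrFun ((hb.mem_BDI_iff P.1).1 P.2 k).2.2 i) j⟩

theorem map_symbol (hb : IsNormalFormBasis σ b) (P : BDI σ d n) (k : Torus d) :
    (symbol hb P).map (evalAt k) = blockQ b (P.1 k) := rfl

theorem det_symbol_apply (hb : IsNormalFormBasis σ b) (P : BDI σ d n) (k : Torus d) :
    (symbol hb P).det.1 k = (blockQ b (P.1 k)).det :=
  RingHom.map_det (evalAt k) (symbol hb P)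

theorem norm_det_blockQ (hb : IsNormalFormBasis σ b) (P : BDI σ d n) (k : Torus d) :
    ‖(blockQ b (P.1 k)).det‖ = 1 :=
  CStarRing.norm_of_mem_unitary (det_of_mem_unitary ((hb.mem_BDI_iff P.1).1 P.2 k).1)

theorem isUnit_det_map {M : Matrix (Fin n) (Fin n) (SymmetricFunction d)} (hM : IsUnit M.det)
    (k : Torus d) : IsUnit (M.map (evalAt k)).det := by
  have h : evalAt k M.det = (M.map (evalAt k)).det := RingHom.map_det (evalAt k) M
  exact h ▸ hM.map (evalAt k)

theorem continuous_map_evalAt {X : Type*} [TopologicalSpace X]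
    {γ : X → Matrix (Fin n) (Fin n) (SymmetricFunction d)} (hγ : Continuous γ) :
    Continuous fun p : X × Torus d => (γ p.1).map (evalAt p.2) :=
  continuous_matrix fun i j => by
    have h : Continuous fun x => (γ x i j).1 := continuous_subtype_val.comp (hγ.matrix_elem i j)
    change Continuous fun p : X × Torus d => (γ p.1 i j).1 p.2
    fun_prop

theorem map_star_evalAt (M : Matrix (Fin n) (Fin n) (SymmetricFunction d)) (k : Torus d) :
    M.map (evalAt (-k)) = (M.map (evalAt k)).map star := by
  ext i j
  exact (M i j).2 k

/-- A path of invertible matrices over the symmetric functions, evaluated at each `k` and replaced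
by its polar unitary part, is a path of admissible blocks. The ends are already unitary, so they do
not move. -/
theorem homotopic_of_joinedIn_det [FiniteDimensional ℂ H] (hb : IsNormalFormBasis σ b)
    (hd : Dense {f : SymmetricFunction d | IsUnit f}) {P₀ P₁ : BDI σ d n}
    (h : JoinedIn {f : SymmetricFunction d | IsUnit f} (symbol hb P₀).det (symbol hb P₁).det) :
    HomotopicInBDI σ P₀ P₁ := by
  obtain ⟨γ, hγ⟩ := joinedIn_of_joinedIn_det hd h
  have hu (s : unitInterval) (k : Torus d) : IsUnit ((γ s).map (evalAt k)).det :=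
    isUnit_det_map (hγ s) k
  let U : C(unitInterval × Torus d, Matrix (Fin n) (Fin n) ℂ) :=
    ⟨fun p => polarUnitary ((γ p.1).map (evalAt p.2)),
      continuousOn_polarUnitary.comp_continuous (continuous_map_evalAt γ.continuous)
        fun p => hu p.1 p.2⟩
  have hend (P : BDI σ d n) (k : Torus d) :
      operatorOf b (chiralProjection (polarUnitary ((symbol hb P).map (evalAt k)))) = P.1 k := by
    obtain ⟨hU, hM, -⟩ := (hb.mem_BDI_iff P.1).1 P.2 k
    refine matrixIn_injective b ?_
    rw [matrixIn_operatorOf, map_symbol, polarUnitary_of_mem hU, hM]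
  refine ⟨⟨⟨projectionOf b U, fun k => ?_, fun k => ?_⟩, fun s => ?_⟩⟩
  · change operatorOf b (chiralProjection (polarUnitary ((γ 0).map (evalAt k)))) = _
    rw [γ.source, hend]
  · change operatorOf b (chiralProjection (polarUnitary ((γ 1).map (evalAt k)))) = _
    rw [γ.target, hend]
  · refine hb.projectionOf_mem (Q := ⟨fun k => U (s, k), by fun_prop⟩)
      (fun k => polarUnitary_mem (hu s k)) fun k => ?_
    change polarUnitary ((γ s).map (evalAt (-k))) = (polarUnitary ((γ s).map (evalAt k))).map star
    rw [map_star_evalAt, polarUnitary_map_star (hu s k)]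

/-- A quantity that does not change under small changes of the determinant is a homotopy
invariant. -/
theorem eq_of_homotopic {α : Type*} (I : BDI σ d n → α)
    (hI : ∀ P P' : BDI σ d n,
      (∀ k, ‖(blockQ b (P.1 k)).det - (blockQ b (P'.1 k)).det‖ < 2) → I P = I P')
    {P₀ P₁ : BDI σ d n} (h : HomotopicInBDI σ P₀ P₁) : I P₀ = I P₁ := by
  obtain ⟨F⟩ := h
  let P (s : unitInterval) : BDI σ d n := ⟨F.toHomotopy.curry s, F.prop' s⟩
  let D (s : unitInterval) : C(Torus d, ℂ) :=
    ⟨fun k => (blockQ b ((P s).1 k)).det,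
      ((continuous_blockQ b).comp (P s).1.continuous).matrix_det⟩
  have hD : Continuous D := ContinuousMap.continuous_of_continuous_uncurry _
    (((continuous_blockQ b).comp F.continuous).matrix_det)
  -- The determinant varies continuously in the uniform norm, so nearby parameters satisfy the
  -- hypothesis of closeness; `[0,1]` is connected.
  have hloc : IsLocallyConstant fun s => I (P s) := by
    refine (IsLocallyConstant.iff_eventually_eq _).2 fun s => ?_
    filter_upwards [hD.continuousAt.eventually (Metric.ball_mem_nhds (D s) two_pos)] with t ht
    refine hI _ _ fun k => ?_
    rw [← dist_eq_norm]
    exact (ContinuousMap.dist_apply_le_dist (f := D t) (g := D s) k).trans_lt ht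
  have h0 : P 0 = P₀ := Subtype.ext (ContinuousMap.ext fun k => F.map_zero_left k)
  have h1 : P 1 = P₁ := Subtype.ext (ContinuousMap.ext fun k => F.map_one_left k)
  rw [← h0, ← h1]
  exact hloc.apply_eq_of_preconnectedSpace 0 1

variable [FiniteDimensional ℂ H]

/-- The block `diag(f, 1, …, 1)` realizes any unimodular symmetric `f` as determinant. -/
theorem exists_det_blockQ_eq (hb : IsNormalFormBasis σ b) (hn : 1 ≤ n)
    (f : SymmetricFunction d) (hf : ∀ k, ‖f.1 k‖ = 1) :
    ∃ P : BDI σ d n, ∀ k, (blockQ b (P.1 k)).det = f.1 k := by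
  let Q : C(Torus d, Matrix (Fin n) (Fin n) ℂ) :=
    ⟨fun k => diagonal (Function.update 1 ⟨0, hn⟩ (f.1 k)),
      (continuous_const.update _ f.1.continuous).matrix_diagonal⟩
  refine ⟨⟨projectionOf b Q, hb.projectionOf_mem (fun k => ?_) fun k => ?_⟩, fun k => ?_⟩
  · rw [mem_unitaryGroup_iff, star_eq_conjTranspose]
    simp only [Q, ContinuousMap.coe_mk, diagonal_conjTranspose, diagonal_mul_diagonal]
    rw [← diagonal_one]
    congr 1
    ext i
    by_cases hi : i = ⟨0, hn⟩
    · simp [hi, Complex.mul_conj, Complex.normSq_eq_norm_sq, hf]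
    · simp [hi]
  · simp only [Q, ContinuousMap.coe_mk]
    rw [f.2, diagonal_map (star_zero ℂ)]
    congr 1
    ext i
    by_cases hi : i = ⟨0, hn⟩
    · simp [hi]
    · simp [hi]
  · rw [blockQ_projectionOf]
    simp [Q, Finset.prod_update_of_mem]

/-- On the one-point torus `-k = k`, so the block equals its own conjugate, and a real unitary
matrix is orthogonal. -/
theorem exists_homeomorph_orthogonalGroup (hb : IsNormalFormBasis σ b) :
    ∃ e : BDI σ 0 n ≃ₜ Matrix.orthogonalGroup (Fin n) ℝ,
      ∀ P : BDI σ 0 n,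
        (e P : Matrix (Fin n) (Fin n) ℝ).map Complex.ofReal = blockQ b (P.1 0) := by
  have hreal (P : BDI σ 0 n) :
      ((blockQ b (P.1 0)).map Complex.re).map Complex.ofReal = blockQ b (P.1 0) := by
    ext i j
    have := congrFun (congrFun ((hb.mem_BDI_iff P.1).1 P.2 0).2.2 i) j
    rw [neg_zero] at this
    exact Complex.conj_eq_iff_re.1 this.symm
  have horth (O : Matrix (Fin n) (Fin n) ℝ) : O ∈ orthogonalGroup (Fin n) ℝ ↔
      O.map Complex.ofReal ∈ unitaryGroup (Fin n) ℂ := by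
    have h1 : star (O.map Complex.ofReal) = Oᵀ.map Complex.ofReal := by
      ext i j; simp
    have h2 : (O * Oᵀ).map Complex.ofReal = O.map Complex.ofReal * Oᵀ.map Complex.ofReal :=
      Matrix.map_mul (f := Complex.ofRealHom)
    have h3 : (1 : Matrix (Fin n) (Fin n) ℂ) = (1 : Matrix (Fin n) (Fin n) ℝ).map Complex.ofReal :=
      (Matrix.map_one _ Complex.ofReal_zero Complex.ofReal_one).symm
    rw [mem_orthogonalGroup_iff, mem_unitaryGroup_iff, h1, ← h2, h3,
      (Matrix.map_injective Complex.ofReal_injective).eq_iff]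
  let toO (P : BDI σ 0 n) : orthogonalGroup (Fin n) ℝ :=
    ⟨(blockQ b (P.1 0)).map Complex.re, (horth _).2 (by
      rw [hreal]; exact ((hb.mem_BDI_iff P.1).1 P.2 0).1)⟩
  let ofO (O : orthogonalGroup (Fin n) ℝ) : BDI σ 0 n :=
    ⟨projectionOf b (ContinuousMap.const _ (O.1.map Complex.ofReal)),
      hb.projectionOf_mem (fun k => (horth _).1 O.2) fun k => by ext i j; simp⟩
  have hofO (O) : blockQ b ((ofO O).1 0) = O.1.map Complex.ofReal := blockQ_projectionOf b _ _
  refine ⟨⟨⟨toO, ofO, fun P => ?_, fun O => ?_⟩, ?_, ?_⟩, hreal⟩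
  · refine Subtype.ext (ContinuousMap.ext fun k => ?_)
    rw [Subsingleton.elim k 0]
    exact hb.eq_of_blockQ_eq (ofO _).2 P.2 ((hofO _).trans (hreal P))
  · refine Subtype.ext ?_
    change (blockQ b ((ofO O).1 0)).map Complex.re = O.1
    rw [hofO]
    ext i j
    simp
  · refine Continuous.subtype_mk (Continuous.matrix_map ?_ Complex.continuous_re) _
    exact (continuous_blockQ b).comp ((continuous_eval_const 0).comp continuous_subtype_val)
  · refine Continuous.subtype_mk (ContinuousMap.continuous_of_continuous_uncurry _ ?_) _
    change Continuous fun p : orthogonalGroup (Fin n) ℝ × Torus 0 =>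
      operatorOf b (chiralProjection (p.1.1.map Complex.ofReal))
    exact (continuous_operatorOf b).comp (continuous_chiralProjection.comp
      ((continuous_subtype_val.comp continuous_fst).matrix_map Complex.continuous_ofReal))

theorem exists_index_zero (hb : IsNormalFormBasis σ b) :
    ∃ index₀ : BDI σ 0 n → ℤˣ,
      (∀ P : BDI σ 0 n, (((index₀ P : ℤˣ) : ℤ) : ℂ) = (blockQ b (P.1 0)).det) ∧
      (∀ P₀ P₁ : BDI σ 0 n, HomotopicInBDI σ P₀ P₁ ↔ index₀ P₀ = index₀ P₁) ∧
      (1 ≤ n → Function.Surjective index₀) := by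
  have hex (P : BDI σ 0 n) : ∃ ε : ℤˣ, ((ε : ℤ) : ℂ) = (blockQ b (P.1 0)).det := by
    simpa only [det_symbol_apply] using exists_sign_eq (symbol hb P).det
      (by rw [det_symbol_apply, norm_det_blockQ hb])
  choose index₀ h₀ using hex
  refine ⟨index₀, h₀, fun P₀ P₁ => ⟨fun h => ?_, fun h => ?_⟩, fun hn ε => ?_⟩
  · exact eq_of_homotopic (b := b) index₀ (fun P P' h => sign_eq_of_norm_sub_lt (by
      rw [h₀, h₀]; exact h 0)) h
  · refine homotopic_of_joinedIn_det hb dense_units_symmetricFunctions_zero ?_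
    have : (symbol hb P₀).det = (symbol hb P₁).det := by
      refine Subtype.ext (ContinuousMap.ext fun k => ?_)
      rw [Subsingleton.elim k 0, det_symbol_apply, det_symbol_apply, ← h₀, ← h₀, h]
    rw [this]
    refine JoinedIn.refl (isUnit_symmetricFunctions fun k => ?_)
    rw [det_symbol_apply, ← norm_ne_zero_iff, norm_det_blockQ hb]
    exact one_ne_zero
  · obtain ⟨P, hP⟩ := exists_det_blockQ_eq hb hn
      (algebraMap ℝ (SymmetricFunction 0) ((ε : ℤ) : ℝ)) (fun k => by
        rw [algebraMap_symmetricFunctions_apply]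
        rcases Int.units_eq_one_or ε with rfl | rfl <;> simp)
    refine ⟨P, sign_eq_of_norm_sub_lt ?_⟩
    rw [h₀, hP, algebraMap_symmetricFunctions_apply]
    simp

/-- The symmetric function `ε exp (2 π i w k)` on the `1`-torus. -/
noncomputable def signedCharacter (ε : ℤˣ) (w : ℤ) : SymmetricFunction 1 :=
  ⟨⟨fun k => ((ε : ℤ) : ℂ) * fourier w (k 0), by fun_prop⟩, fun k => by
    have : fourier w (-k 0) = conj (fourier w (k 0)) := by rw [← fourier_neg]; simp
    simp only [ContinuousMap.coe_mk, Pi.neg_apply]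
    rw [this, map_mul, map_intCast]⟩

theorem hasSemiWinding_signedCharacter (ε : ℤˣ) (w : ℤ) :
    HasSemiWinding (fun k => (signedCharacter ε w).1 (torusPoint k)) w := by
  obtain ⟨a, ha⟩ : ∃ a : ℝ, Complex.exp (Complex.I * (a : ℂ)) = ((ε : ℤ) : ℂ) := by
    rcases Int.units_eq_one_or ε with rfl | rfl
    · exact ⟨0, by simp⟩
    · exact ⟨Real.pi, by rw [mul_comm, Complex.exp_pi_mul_I]; simp⟩
  -- A full turn count `w` over the circle gives a phase change `π w` over `[0, ½]`, so every
  -- integer is attained.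
  refine ⟨fun k => a + 2 * Real.pi * w * k, by fun_prop, fun k _ => ?_, ?_⟩
  · change ((ε : ℤ) : ℂ) * fourier w ((k : ℝ) : UnitAddCircle) = _
    rw [fourier_coe_apply, ← ha, ← Complex.exp_add]
    congr 1
    push_cast
    ring
  · field_simp
    ring

theorem exists_index_one (hb : IsNormalFormBasis σ b) :
    ∃ index₁ : BDI σ 1 n → ℤˣ × ℤ,
      (∀ P : BDI σ 1 n,
        ((((index₁ P).1 : ℤˣ) : ℤ) : ℂ) = (blockQ b (P.1 (torusPoint 0))).det ∧
        HasSemiWinding (fun k => (blockQ b (P.1 (torusPoint k))).det) (index₁ P).2) ∧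
      (∀ P₀ P₁ : BDI σ 1 n, HomotopicInBDI σ P₀ P₁ ↔ index₁ P₀ = index₁ P₁) ∧
      (1 ≤ n → Function.Surjective index₁) := by
  have hnorm (P : BDI σ 1 n) (k) : ‖(symbol hb P).det.1 k‖ = 1 := by
    rw [det_symbol_apply, norm_det_blockQ hb]
  have hex (P : BDI σ 1 n) : ∃ i : ℤˣ × ℤ,
      ((i.1 : ℤ) : ℂ) = (blockQ b (P.1 (torusPoint 0))).det ∧
      HasSemiWinding (fun k => (blockQ b (P.1 (torusPoint k))).det) i.2 := by
    obtain ⟨ε, hε⟩ := exists_sign_eq (symbol hb P).det (hnorm P 0)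
    obtain ⟨w, hw⟩ := exists_hasSemiWinding (symbol hb P).det (hnorm P)
    simp only [det_symbol_apply] at hε hw
    exact ⟨(ε, w), by rw [torusPoint_zero, hε], hw⟩
  choose index₁ h₁ using hex
  have him (P : BDI σ 1 n) {t : ℝ} (ht : -torusPoint t = torusPoint t) :
      (blockQ b (P.1 (torusPoint t))).det.im = 0 := by
    rw [← det_symbol_apply hb]
    exact im_eq_zero_of_neg_eq _ ht
  have hneg0 : -torusPoint 0 = torusPoint 0 := by rw [torusPoint_zero, neg_zero]
  have hclose (P P' : BDI σ 1 n)
      (h : ∀ k, ‖(blockQ b (P.1 k)).det - (blockQ b (P'.1 k)).det‖ < 2) :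
      index₁ P = index₁ P' :=
    Prod.ext (sign_eq_of_norm_sub_lt (by rw [(h₁ P).1, (h₁ P').1]; exact h _))
      ((h₁ P).2.eq_of_norm_sub_lt (h₁ P').2 (him P hneg0) (him P neg_torusPoint_half)
        (him P' hneg0) (him P' neg_torusPoint_half) fun k _ => h _)
  refine ⟨index₁, h₁, fun P₀ P₁ => ⟨eq_of_homotopic (b := b) index₁ hclose, fun h => ?_⟩,
    fun hn ⟨ε, w⟩ => ?_⟩
  · refine homotopic_of_joinedIn_det hb dense_units_symmetricFunctions_one ?_
    refine joinedIn_units_of_hasSemiWinding (w := (index₁ P₀).2)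
      (fun k => norm_ne_zero_iff.1 (by rw [hnorm]; exact one_ne_zero)) ?_ ?_ ?_
    · rw [det_symbol_apply, det_symbol_apply, ← torusPoint_zero, ← (h₁ P₀).1, ← (h₁ P₁).1, h]
    · simpa only [det_symbol_apply] using (h₁ P₀).2
    · simpa only [det_symbol_apply, h] using (h₁ P₁).2
  · have hunit (k) : ‖(signedCharacter ε w).1 k‖ = 1 := by
      change ‖((ε : ℤ) : ℂ) * fourier w (k 0)‖ = 1
      rw [norm_mul, fourier_apply, Circle.norm_coe, mul_one]
      rcases Int.units_eq_one_or ε with rfl | rfl <;> simp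
    obtain ⟨P, hP⟩ := exists_det_blockQ_eq hb hn (signedCharacter ε w) hunit
    refine ⟨P, Prod.ext (sign_eq_of_norm_sub_lt ?_) ?_⟩
    · rw [(h₁ P).1, hP, torusPoint_zero]
      simp [signedCharacter]
    · have hw := hasSemiWinding_signedCharacter ε w
      simp only [← hP] at hw
      -- Uniqueness of the semi-winding is the comparison of a function with itself.
      exact (h₁ P).2.eq_of_norm_sub_lt hw (him P hneg0) (him P neg_torusPoint_half)
        (him P hneg0) (him P neg_torusPoint_half) fun k _ => by simp

end Classification

theorem mainTheorem2 {H : Type*} [NormedAddCommGroup H] [InnerProductSpace ℂ H]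
    [FiniteDimensional ℂ H] (n N : ℕ) (hN : Module.finrank ℂ H = N) :
    -- non-emptiness, in every dimension `d`
    (∀ d : ℕ, (∃ σ : BDISymmetry H, (BDI σ d n).Nonempty) ↔ N = 2 * n) ∧
    -- existence of a basis in which the symmetries have their normal form
    (∀ (σ : BDISymmetry H) (d : ℕ), (BDI σ d n).Nonempty →
      ∃ b : OrthonormalBasis (Fin n ⊕ Fin n) ℂ H, IsNormalFormBasis σ b) ∧
    (∀ (σ : BDISymmetry H) (b : OrthonormalBasis (Fin n ⊕ Fin n) ℂ H), IsNormalFormBasis σ b →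
      -- in such a basis, `P(k) = ½ [[1, Q(k)], [Q(k)*, 1]]` with `Q(k)` unitary
      (∀ (d : ℕ) (P : BDI σ d n) (k : Torus d),
        blockQ b (P.1 k) ∈ Matrix.unitaryGroup (Fin n) ℂ ∧
        matrixIn b (P.1 k) = (1 / 2 : ℂ) •
          Matrix.fromBlocks 1 (blockQ b (P.1 k)) (blockQ b (P.1 k)).conjTranspose 1) ∧
      -- `P ↦ Q` identifies `BDI(0, n, 2n)` with `O(n)`
      (∃ e : BDI σ 0 n ≃ₜ Matrix.orthogonalGroup (Fin n) ℝ,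
        ∀ P : BDI σ 0 n,
          (e P : Matrix (Fin n) (Fin n) ℝ).map Complex.ofReal = blockQ b (P.1 0)) ∧
      -- the index in dimension `0`
      (∃ index₀ : BDI σ 0 n → ℤˣ,
        (∀ P : BDI σ 0 n, (((index₀ P : ℤˣ) : ℤ) : ℂ) = (blockQ b (P.1 0)).det) ∧
        (∀ P₀ P₁ : BDI σ 0 n, HomotopicInBDI σ P₀ P₁ ↔ index₀ P₀ = index₀ P₁) ∧
        (1 ≤ n → Function.Surjective index₀)) ∧
      -- the index in dimension `1`
      (∃ index₁ : BDI σ 1 n → ℤˣ × ℤ,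
        (∀ P : BDI σ 1 n,
          ((((index₁ P).1 : ℤˣ) : ℤ) : ℂ) = (blockQ b (P.1 (torusPoint 0))).det ∧
          HasSemiWinding (fun k => (blockQ b (P.1 (torusPoint k))).det) (index₁ P).2) ∧
        (∀ P₀ P₁ : BDI σ 1 n, HomotopicInBDI σ P₀ P₁ ↔ index₁ P₀ = index₁ P₁) ∧
        (1 ≤ n → Function.Surjective index₁))) := by
  refine ⟨fun d => exists_nonempty_BDI_iff d n N hN, fun σ d h => ?_, fun σ b hb => ⟨?_,
    exists_homeomorph_orthogonalGroup hb, exists_index_zero hb, exists_index_one hb⟩⟩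
  · obtain ⟨A, hA, hT, hC⟩ := exists_projection_of_nonempty h
    exact exists_isNormalFormBasis hA hT hC
  · intro d P k
    obtain ⟨hU, hM, -⟩ := (hb.mem_BDI_iff P.1).1 P.2 k
    exact ⟨hU, hM⟩
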